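/- **Model.** A generalized switch has $n$ queues, a finite set $\mathcal M$ of channel states with probability mass function $\psi$, and, for each $m\in\mathcal M$, a finite nonempty set $\mathcal S^{(m)}\subset\mathbb Z_+^n$ of feasible service vectors that contains the projections of its elements on the coordinate axes. In each slot, with queue lengths $q\in\mathbb Z_+^n$, the channel state $M\sim\psi$ is drawn independently of the past, a scheduling policy selects (possibly at random, given $q$ and $M$) a vector $s\in\mathcal S^{(M)}$, an arrival vector $a\in\mathbb Z_+^n$ independent of everything else and i.i.d. over time is drawn, and the new queue lengths are $q_i^+=q_i+a_i-s_i+u_i=\max\{q_i+a_i-s_i,0\}$. The MaxWeight policy selects $s\in\arg\max_{x\in\mathcal S^{(M)}}\langle q,x\rangle$, ties being broken at random, where every maximizer is selected with probability at least a fixed $\theta>0$ (for instance uniformly). The capacity region $\mathcal C=\sum_m\psi_m\,\mathrm{ConvexHull}(\mathcal S^{(m)})$ is written as $\mathcal C=\{x\in\mathbb R^n_+:\langle c^{(\ell)},x\rangle\le b^{(\ell)},\ \ell=1,\dots,L\}$ with $c^{(\ell)}\ge 0$, $\|c^{(\ell)}\|=1$, $b^{(\ell)}>0$; let $\mathcal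 F^{(\ell)}=\{x\in\mathcal C:\langle c^{(\ell)},x\rangle=b^{(\ell)}\}$. Put $b^{(m,\ell)}=\max_{x\in\mathcal S^{(m)}}\langle c^{(\ell)},x\rangle$ and $b_{\max}=\max_{m,\ell}b^{(m,\ell)}$, and let $\sigma_{B_\ell}^2$ be the variance of the random variable $B_\ell$ with $P(B_\ell=b^{(m,\ell)})=\psi_m$. Fix $\ell$ such that $\mathcal F^{(\ell)}$ is a facet (of dimension $n-1$), a vector $\nu$ in the relative interior of $\mathcal F^{(\ell)}$ (complete resource pooling), and a constant $A_{\max}$. For $\varepsilon\in(0,1)$ let the arrival vector $a^{(\varepsilon)}$ have mean $(1-\varepsilon)\nu$, coordinates bounded by $A_{\max}$ and covariance matrix $\Sigma_a^{(\varepsilon)}$. A steady state $\bar q$ of a policy is a random vector whose law is invariant for the queue-length chain under this policy. Define $$\mathrm{ULB}=\frac{1}{2\varepsilon b^{(\ell)}}\left((c^{(\ell)})^T\Sigma_a^{(\varepsilon)}c^{(\ell)}+\sigma_{B_\ell}^2\right)-\frac{(1-\varepsilon)\,b_{\max}}{2}.$$ **Statement.** 1. (Universal lower bound.) For every $\varepsilon\in(0,1)$,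 every scheduling policy and every steady state $\bar q$ of it (with $E\langle\bar q,c^{(\ell)}\rangle<\infty$, the other case being trivial), $$E\langle\bar q,c^{(\ell)}\rangle\ \ge\ \mathrm{ULB}-\frac{\varepsilon\,(b_{\max}-b^{(\ell)})}{2}.$$ 2. There are constants $\varepsilon_0\in(0,1)$ and $\tilde\beta$, which do not depend on $\varepsilon$, such that for every $\varepsilon\in(0,\varepsilon_0)$ every steady state $\bar q^{(\varepsilon)}$ of MaxWeight satisfies $E\langle\bar q^{(\varepsilon)},c^{(\ell)}\rangle<\infty$ and $$\mathrm{ULB}\ \le\ E\langle\bar q^{(\varepsilon)},c^{(\ell)}\rangle\ \le\ \mathrm{ULB}+\tilde\beta\log\left(\frac1\varepsilon\right).$$ 3. With the same constants, MaxWeight is within $\tilde\beta\log(1/\varepsilon)$ of the optimal policy: for every $\varepsilon\in(0,\varepsilon_0)$ and every steady state $\bar q'$ of any scheduling policy for the same arrival law, $E\langle\bar q^{(\varepsilon)},c^{(\ell)}\rangle\le E\langle\bar q',c^{(\ell)}\rangle+\tilde\beta\log(1/\varepsilon)$. -/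

import Mathlib

open MeasureTheory ProbabilityTheory
open scoped Matrix

/-- A vector of natural numbers (queue lengths, arrivals, services), seen as a real vector. -/
def toRealVec {n : ℕ} (x : Fin n → ℕ) : Fin n → ℝ := fun i => (x i : ℝ)

/-- The capacity region `∑ m, ψ m • ConvexHull (S m)` (a weighted Minkowski sum). -/
def capacityRegion {n : ℕ} {M : Type*} [Fintype M] (ψ : PMF M) (S : M → Finset (Fin n → ℕ)) :
    Set (Fin n → ℝ) :=
  {x | ∃ y : M → Fin n → ℝ,
    (∀ m, y m ∈ convexHull ℝ (toRealVec '' (S m : Set (Fin n → ℕ)))) ∧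
      x = ∑ m, (ψ m).toReal • y m}

/-- The data of a generalized switch that do not depend on the heavy-traffic parameter: `n` queues,
a finite set `M` of channel states, and a description of the capacity region by `L` inequalities. -/
structure GenSwitch (n L : ℕ) (M : Type*) [Fintype M] where
  /-- the probability mass function of the channel state -/
  ψ : PMF M
  /-- the finite set of feasible service vectors in each channel state -/
  S : M → Finset (Fin n → ℕ)
  S_nonempty : ∀ m, (S m).Nonempty
  /-- the feasible sets contain the projections of their elements on the coordinate axes -/
  S_proj : ∀ m, ∀ s ∈ S m, ∀ i, Pi.single i (s i) ∈ S m
  /-- the normal vectors of the capacity region -/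
  c : Fin L → Fin n → ℝ
  /-- the right-hand sides of the inequalities that describe the capacity region -/
  b : Fin L → ℝ
  c_nonneg : ∀ l i, 0 ≤ c l i
  c_norm : ∀ l, c l ⬝ᵥ c l = 1
  b_pos : ∀ l, 0 < b l
  capacity_eq : capacityRegion ψ S = {x | (∀ i, 0 ≤ x i) ∧ ∀ l, c l ⬝ᵥ x ≤ b l}

/-- The queue lengths after one slot, from queue lengths `q`, arrivals `a`, offered service `s`. The
subtraction of natural numbers is truncated at zero in each coordinate. -/
def nextQueue {n : ℕ} (q a s : Fin n → ℕ) : Fin n → ℕ := fun i => q i + a i - s i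

/-- The unused service. -/
def unusedService {n : ℕ} (q a s : Fin n → ℕ) : Fin n → ℕ := fun i => s i - (q i + a i)

/-- The queue recursion `q⁺ = q + a - s + u` (written without subtraction) and `q⁺ u = 0`. -/
theorem nextQueue_spec {n : ℕ} (q a s : Fin n → ℕ) (i : Fin n) :
    nextQueue q a s i + s i = q i + a i + unusedService q a s i ∧
      nextQueue q a s i * unusedService q a s i = 0 := by
  refine ⟨by simp only [nextQueue, unusedService]; omega, ?_⟩
  rw [Nat.mul_eq_zero]
  simp only [nextQueue, unusedService]
  omega

namespace GenSwitch

variable {n L : ℕ} {M : Type*} [Fintype M]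

/-- The face of the capacity region on which the `l`-th inequality is tight. -/
def face (G : GenSwitch n L M) (l : Fin L) : Set (Fin n → ℝ) :=
  {x | x ∈ capacityRegion G.ψ G.S ∧ G.c l ⬝ᵥ x = G.b l}

/-- The `l`-th face is a facet: a face of dimension `n - 1`. -/
def IsFacet (G : GenSwitch n L M) (l : Fin L) : Prop :=
  (G.face l).Nonempty ∧ Module.finrank ℝ (vectorSpan ℝ (G.face l)) + 1 = n

/-- The maximal `c l`-weighted service in channel state `m`. -/
noncomputable def maxService (G : GenSwitch n L M) (m : M) (l : Fin L) : ℝ :=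
  (G.S m).sup' (G.S_nonempty m) fun s => G.c l ⬝ᵥ toRealVec s

/-- The mean of `B_l`, the random variable that takes the value `maxService m l` with
probability `ψ m`. -/
noncomputable def meanB (G : GenSwitch n L M) (l : Fin L) : ℝ :=
  ∑ m, (G.ψ m).toReal * G.maxService m l

/-- The variance of `B_l`. -/
noncomputable def varB (G : GenSwitch n L M) (l : Fin L) : ℝ :=
  ∑ m, (G.ψ m).toReal * (G.maxService m l - G.meanB l) ^ 2

/-- The maximum of `maxService m l` over all `m` and `l`. -/
noncomputable def bMax (G : GenSwitch n L M) : ℝ :=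
  ⨆ p : M × Fin L, G.maxService p.1 p.2

/-- The maximizers of the weighted service `⟨q, x⟩` over the feasible set of channel state `m`. -/
def argmaxSet (G : GenSwitch n L M) (q : Fin n → ℕ) (m : M) : Set (Fin n → ℕ) :=
  {s | s ∈ G.S m ∧ ∀ x ∈ G.S m, q ⬝ᵥ x ≤ q ⬝ᵥ s}

/-- A scheduling policy: given the queue lengths and the channel state it selects, possibly at
random, a feasible service vector. -/
def IsPolicy (G : GenSwitch n L M) (σ : (Fin n → ℕ) → M → PMF (Fin n → ℕ)) : Prop :=
  ∀ q m, ∀ s ∈ (σ q m).support, s ∈ G.S m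

/-- A MaxWeight policy with random tie-breaking: only maximizers of `⟨q, x⟩` are selected, and each
of them is selected with probability at least `θ` (uniform tie-breaking is an example). -/
def IsMaxWeight (G : GenSwitch n L M) (θ : ℝ) (σ : (Fin n → ℕ) → M → PMF (Fin n → ℕ)) : Prop :=
  ∀ q m, (∀ s ∈ (σ q m).support, s ∈ G.argmaxSet q m) ∧
    ∀ s ∈ G.argmaxSet q m, θ ≤ (σ q m s).toReal

/-- An arrival law with mean vector `lam` and all coordinates bounded by `Amax`. -/
def IsArrivalLaw (lam : Fin n → ℝ) (Amax : ℕ) (α : PMF (Fin n → ℕ)) : Prop :=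
  (∀ a ∈ α.support, ∀ i, a i ≤ Amax) ∧ ∀ i, ∫ a, (a i : ℝ) ∂α.toMeasure = lam i

/-- The covariance matrix of the arrival vector. -/
noncomputable def arrivalCov (α : PMF (Fin n → ℕ)) : Matrix (Fin n) (Fin n) ℝ :=
  Matrix.of fun i j =>
    cov[fun a : Fin n → ℕ => (a i : ℝ), fun a : Fin n → ℕ => (a j : ℝ); α.toMeasure]

/-- The law of the queue lengths after one slot started from `q`: the channel state is drawn, then
the policy selects a schedule, then independent arrivals occur, then jobs are served. -/
noncomputable def step (G : GenSwitch n L M) (α : PMF (Fin n → ℕ))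
    (σ : (Fin n → ℕ) → M → PMF (Fin n → ℕ)) (q : Fin n → ℕ) : PMF (Fin n → ℕ) :=
  G.ψ.bind fun m => (σ q m).bind fun s => α.bind fun a => PMF.pure (nextQueue q a s)

/-- `π` is a steady-state law of the queue-length Markov chain. -/
def IsSteadyState (G : GenSwitch n L M) (α : PMF (Fin n → ℕ))
    (σ : (Fin n → ℕ) → M → PMF (Fin n → ℕ)) (π : PMF (Fin n → ℕ)) : Prop :=
  π.bind (G.step α σ) = π

/-- The weighted queue length `⟨q, c l⟩` has a finite mean under `π`. -/
def FiniteMean (G : GenSwitch n L M) (l : Fin L) (π : PMF (Fin n → ℕ)) : Prop :=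
  Integrable (fun q : Fin n → ℕ => toRealVec q ⬝ᵥ G.c l) π.toMeasure

/-- The mean of the weighted queue length `⟨q, c l⟩` under `π`. -/
noncomputable def meanQueue (G : GenSwitch n L M) (l : Fin L) (π : PMF (Fin n → ℕ)) : ℝ :=
  ∫ q, toRealVec q ⬝ᵥ G.c l ∂π.toMeasure

/-- The quantity `ULB`. -/
noncomputable def ULB (G : GenSwitch n L M) (l : Fin L) (α : PMF (Fin n → ℕ)) (ε : ℝ) : ℝ :=
  1 / (2 * ε * G.b l) * (G.c l ⬝ᵥ (arrivalCov α *ᵥ G.c l) + G.varB l) - (1 - ε) * G.bMax / 2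

end GenSwitch

/-!
Write `Q = ⟨q, c⟩` for the weighted queue length of a facet with normal vector `c` and level `b`,
`A = ⟨c, a⟩` for the weighted arrivals and `B` for the largest weighted service in the current
channel state. One slot changes `Q` into `Q⁺ = Q + A - B + U`, where the lost service `U`
(`lostService`) is the sum of the loss due to a schedule that is not optimal for `c` and of the
weighted unused service; it lies between `0` and `B`. Zero steady-state drift of `Q` and of `Q ^ 2`
gives `E U = ε b` and

  `2 ε b E Q = ⟨c, Σ c⟩ + σ_B ^ 2 + (ε b) ^ 2 + 2 E (Q⁺ U) - E (U ^ 2)`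

(`IsSteadyState.integral_lostService`, `IsSteadyState.mean_identity`). No second moment is needed,
because the drift of an arbitrary function with integrable increments vanishes
(`IsStationaryStep.integral_drift_eq_zero`). All three claims are estimates of the last two terms.

* For any policy `Q⁺ U ≥ 0` and `U ^ 2 ≤ bMax * U`; this is the universal lower bound.
* For MaxWeight, a fixed fraction of `E U = ε b` bounds `E (U (bMax - U) + 2 Q⁺ U)` from below
  (`exists_lossSlack_ge`), which beats the correction term of order `ε ^ 2`. The only obstruction
  would be that work is lost in slots that end with `Q⁺ = 0` and lose exactly `bMax`. Such slots
  start with `Q = 0`, and there random tie-breaking selects with positive probability a schedule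
  without weighted service, so that arrivals remain in the queues while work is lost. That such a
  schedule is among the maximizers follows from the capacity region being closed under lowering
  coordinates (`exists_mem_argmaxSet_eq_zero`).
* For the upper bound it remains to show `E (Q⁺ U) = O(ε log (1 / ε))`. Whenever `U > 0` under
  MaxWeight, `Q⁺` is at most affine in the norm `x` of the component of `q` orthogonal to `c`
  (`exists_next_mul_lostService_le`): a queue with unused service is empty, and a schedule that is
  not optimal for `c` is selected only if `q` is not aligned with `c`. By complete resource pooling
  `x` has negative drift, hence `E exp (κ x)` is bounded uniformly in `ε`
  (`IsFacet.exists_stateSpaceCollapse`). Since `x ≤ log (1 / ε) / κ + (ε / κ) exp (κ x)`, the claim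
  follows from `E U = ε b`.

Given the queue lengths, a slot has finitely many outcomes, so conditional means are finite sums
(`slotMean`), and only the means over the queue lengths are integrals.
-/

/-! ### Stationary laws of chains with finitely many transitions per state -/

/-- The measure `μ` is stationary for the chain that moves from `x` to `next x t` with
probability `w x t`, where `t` ranges over a fixed finite set `T`. Invariance is only demanded for
bounded nonnegative test functions, so that it is never an identity between junk integrals. -/
structure IsStationaryStep {X ι : Type*} [MeasurableSpace X] (μ : Measure X) (T : Finset ι)
    (w : X → ι → ℝ) (next : X → ι → X) : Prop where
  nonneg : ∀ x, ∀ t ∈ T, 0 ≤ w x t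
  sum_eq_one : ∀ x, ∑ t ∈ T, w x t = 1
  integral_eq : ∀ (f : X → ℝ) (N : ℝ), (∀ x, 0 ≤ f x) → (∀ x, f x ≤ N) →
    ∫ x, ∑ t ∈ T, w x t * f (next x t) ∂μ = ∫ x, f x ∂μ

namespace IsStationaryStep

variable {X ι : Type*} [MeasurableSpace X] {μ : Measure X} {T : Finset ι} {w : X → ι → ℝ}
  {next : X → ι → X}

/-- Bounds on a mean over the transitions need only hold for transitions of positive
probability. -/
theorem step_le (h : IsStationaryStep μ T w next) {x : X} {f : ι → ℝ} {N : ℝ}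
    (hf : ∀ t ∈ T, w x t ≠ 0 → f t ≤ N) : ∑ t ∈ T, w x t * f t ≤ N := by
  calc ∑ t ∈ T, w x t * f t ≤ ∑ t ∈ T, w x t * N := by
        refine Finset.sum_le_sum fun t ht => ?_
        by_cases hw : w x t = 0
        · simp [hw]
        · exact mul_le_mul_of_nonneg_left (hf t ht hw) (h.nonneg x t ht)
    _ = N := by rw [← Finset.sum_mul, h.sum_eq_one, one_mul]

theorem le_step (h : IsStationaryStep μ T w next) {x : X} {f : ι → ℝ} {N : ℝ}
    (hf : ∀ t ∈ T, w x t ≠ 0 → N ≤ f t) : N ≤ ∑ t ∈ T, w x t * f t := by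
  have := h.step_le (x := x) (f := fun t => - f t) (N := -N) fun t ht hw => by
    have := hf t ht hw; linarith
  simp only [mul_neg, Finset.sum_neg_distrib] at this
  linarith

variable [DiscreteMeasurableSpace X] [IsProbabilityMeasure μ]

omit [IsProbabilityMeasure μ] in
theorem integrable_of_abs_le {f h : X → ℝ} (hh : Integrable h μ) (hf : ∀ x, |f x| ≤ h x) :
    Integrable f μ :=
  hh.mono' (Measurable.of_discrete.aestronglyMeasurable) (.of_forall hf)

theorem integrable_of_bounded {f : X → ℝ} {N : ℝ} (h : ∀ x, |f x| ≤ N) : Integrable f μ :=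
  integrable_of_abs_le (integrable_const N) h

/-- Foster's criterion for a given stationary law. The test function `f` need not be integrable:
invariance is applied to `min f N`, and `N` tends to infinity. -/
theorem foster (h : IsStationaryStep μ T w next) {f g : X → ℝ} {K : ℝ} (hf : ∀ x, 0 ≤ f x)
    (hg : ∀ x, 0 ≤ g x) (hK : 0 ≤ K)
    (drift : ∀ x, ∑ t ∈ T, w x t * f (next x t) ≤ f x - g x + K) :
    Integrable g μ ∧ ∫ x, g x ∂μ ≤ K := by
  have hgf : ∀ x, g x ≤ f x + K := fun x => by
    have := h.le_step (x := x) (f := fun t => f (next x t)) (N := 0) fun t _ _ => hf _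
    linarith [drift x]
  set gN : ℕ → X → ℝ := fun N x => if f x ≤ N then g x else 0 with hgN
  have hgN0 : ∀ N x, 0 ≤ gN N x := fun N x => by
    simp only [hgN]; split_ifs
    exacts [hg x, le_rfl]
  have hgNi : ∀ N, Integrable (gN N) μ := fun N => by
    refine integrable_of_bounded (N := N + K) fun x => ?_
    rw [abs_of_nonneg (hgN0 N x)]
    simp only [hgN]; split_ifs with h1
    · linarith [hgf x]
    · positivity
  have hint : ∀ N, ∫ x, gN N x ∂μ ≤ K := fun N => by
    set F : X → ℝ := fun x => min (f x) N with hF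
    have hF0 : ∀ x, 0 ≤ F x := fun x => le_min (hf x) (Nat.cast_nonneg N)
    have hFN : ∀ x, F x ≤ N := fun x => min_le_right _ _
    have hPN : ∀ x, ∑ t ∈ T, w x t * F (next x t) ≤ N := fun x => h.step_le fun t _ _ => hFN _
    have hP0 : ∀ x, 0 ≤ ∑ t ∈ T, w x t * F (next x t) := fun x => h.le_step fun t _ _ => hF0 _
    have hFi : Integrable F μ :=
      integrable_of_bounded (N := N) fun x => by rw [abs_of_nonneg (hF0 x)]; exact hFN x
    have hPi : Integrable (fun x => ∑ t ∈ T, w x t * F (next x t)) μ :=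
      integrable_of_bounded (N := N) fun x => by rw [abs_of_nonneg (hP0 x)]; exact hPN x
    have key : ∀ x, gN N x ≤ F x - ∑ t ∈ T, w x t * F (next x t) + K := fun x => by
      simp only [hgN]; split_ifs with h1
      · have : ∑ t ∈ T, w x t * F (next x t) ≤ ∑ t ∈ T, w x t * f (next x t) :=
          Finset.sum_le_sum fun t ht =>
            mul_le_mul_of_nonneg_left (min_le_left _ _) (h.nonneg x t ht)
        have h2 : F x = f x := min_eq_left h1
        linarith [drift x]
      · have h2 : F x = N := min_eq_right (not_le.1 h1).le
        linarith [hPN x]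
    have := integral_mono (hgNi N) ((hFi.sub hPi).add (integrable_const K)) key
    refine this.trans_eq ?_
    rw [integral_add' (hFi.sub hPi) (integrable_const K), integral_sub' hFi hPi,
      h.integral_eq F N hF0 hFN]
    simp
  have hlim : ∫⁻ x, ENNReal.ofReal (g x) ∂μ ≤ ENNReal.ofReal K := by
    refine le_of_tendsto' (lintegral_tendsto_of_tendsto_of_monotone
      (f := fun (N : ℕ) x => ENNReal.ofReal (gN N x))
      (fun N => Measurable.of_discrete.aemeasurable) (.of_forall fun x => ?_)
      (.of_forall fun x => ?_)) fun N => ?_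
    · refine fun N N' hNN' => ENNReal.ofReal_le_ofReal ?_
      simp only [hgN]; split_ifs with h1 h2
      · exact le_rfl
      · exact absurd (h1.trans (Nat.cast_le.2 hNN')) h2
      · exact hg x
      · exact le_rfl
    · refine tendsto_const_nhds.congr' ?_
      filter_upwards [Filter.eventually_ge_atTop ⌈f x⌉₊] with N hN
      simp only [hgN]
      rw [if_pos ((Nat.le_ceil _).trans (Nat.cast_le.2 hN))]
    · rw [← ofReal_integral_eq_lintegral_ofReal (hgNi N) (.of_forall (hgN0 N))]
      exact ENNReal.ofReal_le_ofReal (hint N)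
  have hi : Integrable g μ := by
    refine ⟨Measurable.of_discrete.aestronglyMeasurable, ?_⟩
    rw [hasFiniteIntegral_iff_ofReal (.of_forall hg)]
    exact hlim.trans_lt ENNReal.ofReal_lt_top
  refine ⟨hi, ?_⟩
  rw [← ofReal_integral_eq_lintegral_ofReal hi (.of_forall hg)] at hlim
  exact (ENNReal.ofReal_le_ofReal_iff hK).1 hlim

/-- The mean drift of `f` vanishes in steady state as soon as the increments of `f` are dominated
by an integrable function, even if `f` itself is not integrable. -/
theorem integral_drift_eq_zero (h : IsStationaryStep μ T w next) {f g : X → ℝ}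
    (hf : ∀ x, 0 ≤ f x) (hg : Integrable g μ)
    (hb : ∀ x, ∀ t ∈ T, w x t ≠ 0 → |f (next x t) - f x| ≤ g x) :
    ∫ x, ∑ t ∈ T, w x t * (f (next x t) - f x) ∂μ = 0 := by
  have hle : ∀ x, ∀ u : ι → ℝ, (∀ t ∈ T, w x t ≠ 0 → |u t| ≤ g x) →
      |∑ t ∈ T, w x t * u t| ≤ g x := fun x u hu => by
    rw [abs_le]
    exact ⟨h.le_step fun t ht hw => (abs_le.1 (hu t ht hw)).1,
      h.step_le fun t ht hw => (abs_le.1 (hu t ht hw)).2⟩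
  have hmin : ∀ a b N : ℝ, |min a N - min b N| ≤ |a - b| := fun a b N => by
    simpa using abs_min_sub_min_le_max a N b N
  have hlim : Filter.Tendsto
      (fun N : ℕ => ∫ x, ∑ t ∈ T, w x t * (min (f (next x t)) N - min (f x) N) ∂μ) Filter.atTop
      (nhds (∫ x, ∑ t ∈ T, w x t * (f (next x t) - f x) ∂μ)) := by
    refine tendsto_integral_of_dominated_convergence g
      (fun N => Measurable.of_discrete.aestronglyMeasurable) hg
      (fun N => .of_forall fun x => ?_) (.of_forall fun x => ?_)
    · exact hle x _ fun t ht hw => (hmin _ _ _).trans (hb x t ht hw)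
    · have hev : ∀ r : ℝ, Filter.Tendsto (fun N : ℕ => min r (N : ℝ)) Filter.atTop (nhds r) := by
        intro r
        refine tendsto_const_nhds.congr' ?_
        filter_upwards [Filter.eventually_ge_atTop ⌈r⌉₊] with N hN
        rw [min_eq_left ((Nat.le_ceil _).trans (Nat.cast_le.2 hN))]
      exact tendsto_finsetSum _ fun t _ => ((hev _).sub (hev _)).const_mul _
  refine tendsto_nhds_unique hlim ?_
  refine tendsto_const_nhds.congr fun N => ?_
  set F : X → ℝ := fun x => min (f x) N with hF
  have hF0 : ∀ x, 0 ≤ F x := fun x => le_min (hf x) (Nat.cast_nonneg N)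
  have hFN : ∀ x, F x ≤ N := fun x => min_le_right _ _
  have hPN : ∀ x, ∑ t ∈ T, w x t * F (next x t) ≤ N := fun x => h.step_le fun t _ _ => hFN _
  have hP0 : ∀ x, 0 ≤ ∑ t ∈ T, w x t * F (next x t) := fun x => h.le_step fun t _ _ => hF0 _
  have hFi : Integrable F μ :=
    integrable_of_bounded (N := N) fun x => by rw [abs_of_nonneg (hF0 x)]; exact hFN x
  have hPi : Integrable (fun x => ∑ t ∈ T, w x t * F (next x t)) μ :=
    integrable_of_bounded (N := N) fun x => by rw [abs_of_nonneg (hP0 x)]; exact hPN x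
  have hsplit : ∀ x, ∑ t ∈ T, w x t * (F (next x t) - F x) =
      ∑ t ∈ T, w x t * F (next x t) - F x := fun x => by
    simp only [mul_sub, Finset.sum_sub_distrib, ← Finset.sum_mul, h.sum_eq_one, one_mul]
  simp only [hF] at hsplit
  simp only [hsplit]
  rw [integral_sub hPi hFi, h.integral_eq F N hF0 hFN, sub_self]

/-- A chain with bounded increments of `V` and with a drift of `V ^ 2` of order `-r * V` has an
exponential moment of `V` in steady state. The exponent and the bound depend only on the constants
in these two conditions, so they are uniform over families of chains. -/
theorem exists_integral_exp_le {X ι : Type*} [MeasurableSpace X] [DiscreteMeasurableSpace X]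
    {D r K : ℝ} (hD : 0 < D) (hr : 0 < r) (hK : 0 < K) (V : X → ℝ) :
    ∃ κ > 0, ∃ C, 0 ≤ C ∧ ∀ (μ : Measure X) [IsProbabilityMeasure μ] (T : Finset ι)
      (w : X → ι → ℝ) (next : X → ι → X), IsStationaryStep μ T w next →
      (∀ x, ∀ t ∈ T, w x t ≠ 0 → |V (next x t) - V x| ≤ D) →
      (∀ x, ∑ t ∈ T, w x t * (V (next x t) ^ 2 - V x ^ 2) ≤ -r * V x + K) →
      Integrable (fun x => Real.exp (κ * V x)) μ ∧ ∫ x, Real.exp (κ * V x) ∂μ ≤ C := by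
  obtain ⟨κ, hκ, h1, h2, h3⟩ : ∃ κ > 0, κ * D ≤ 1 ∧ κ * D ^ 2 ≤ r / 8 ∧ κ * r ≤ 8 := by
    refine ⟨min (1 / D) (min (r / 8 / D ^ 2) (8 / r)), by positivity, ?_, ?_, ?_⟩
    · rw [← le_div_iff₀ hD]; exact min_le_left _ _
    · rw [← le_div_iff₀ (by positivity)]; exact (min_le_right _ _).trans (min_le_left _ _)
    · rw [← le_div_iff₀ hr]; exact (min_le_right _ _).trans (min_le_right _ _)
  set K' := Real.exp (κ * (2 * K / r + D)) with hK'
  have hK'0 : 0 < K' := Real.exp_pos _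
  have hc : 0 < κ * r / 8 := by positivity
  refine ⟨κ, hκ, K' / (κ * r / 8), by positivity, fun μ _ T w next h hjump hdrift => ?_⟩
  have key := h.foster (f := fun x => Real.exp (κ * V x))
    (g := fun x => κ * r / 8 * Real.exp (κ * V x)) (K := K') (fun x => (Real.exp_pos _).le)
    (fun x => by positivity) hK'0.le fun x => ?_
  · obtain ⟨hi, hle⟩ := key
    have hi' : Integrable (fun x => Real.exp (κ * V x)) μ := by
      have := hi.const_mul (κ * r / 8)⁻¹
      simpa only [← mul_assoc, inv_mul_cancel₀ hc.ne', one_mul] using this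
    rw [integral_const_mul] at hle
    exact ⟨hi', by rw [le_div_iff₀ hc]; linarith⟩
  · rcases le_or_gt (2 * K / r) (V x) with hx | hx
    · set f := Real.exp (κ * V x) with hf
      have hf0 : 0 < f := Real.exp_pos _
      have hstep : ∑ t ∈ T, w x t * (V (next x t) - V x) ≤ -(r / 4) := by
        -- Here `K > 0` ensures that the region `2 * K / r ≤ V x` excludes `V x = 0`.
        have h0 : 0 < V x := lt_of_lt_of_le (by positivity) hx
        have hpt : ∀ t, 2 * V x * (V (next x t) - V x) ≤ V (next x t) ^ 2 - V x ^ 2 :=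
          fun t => by nlinarith [sq_nonneg (V (next x t) - V x)]
        have h4 : 2 * V x * ∑ t ∈ T, w x t * (V (next x t) - V x) ≤ -r * V x + K := by
          refine le_trans ?_ (hdrift x)
          rw [Finset.mul_sum]
          refine Finset.sum_le_sum fun t ht => ?_
          have := mul_le_mul_of_nonneg_left (hpt t) (h.nonneg x t ht)
          linarith
        rw [div_le_iff₀ hr] at hx
        nlinarith
      have hexp : ∀ t ∈ T, w x t * Real.exp (κ * V (next x t)) ≤
          w x t * (f * (1 + κ ^ 2 * D ^ 2)) + f * κ * (w x t * (V (next x t) - V x)) := by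
        intro t ht
        by_cases hw : w x t = 0
        · simp [hw]
        have hj := hjump x t ht hw
        set y := V (next x t) - V x with hy
        have hky : |κ * y| ≤ 1 := by
          rw [abs_mul, abs_of_pos hκ]
          exact (mul_le_mul_of_nonneg_left hj hκ.le).trans h1
        have h5 := (abs_le.1 (Real.abs_exp_sub_one_sub_id_le hky)).2
        have h6 : (κ * y) ^ 2 ≤ κ ^ 2 * D ^ 2 := by
          rw [mul_pow]
          exact mul_le_mul_of_nonneg_left (sq_le_sq' (abs_le.1 hj).1 (abs_le.1 hj).2)
            (sq_nonneg κ)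
        have h7 : Real.exp (κ * V (next x t)) = f * Real.exp (κ * y) := by
          rw [hf, ← Real.exp_add, hy]; ring_nf
        have h8 : Real.exp (κ * V (next x t)) ≤ f * (1 + κ ^ 2 * D ^ 2) + f * κ * y := by
          rw [h7]
          nlinarith
        calc _ ≤ w x t * (f * (1 + κ ^ 2 * D ^ 2) + f * κ * y) :=
              mul_le_mul_of_nonneg_left h8 (h.nonneg x t ht)
          _ = _ := by ring
      have h9 := Finset.sum_le_sum hexp
      rw [Finset.sum_add_distrib, ← Finset.sum_mul, h.sum_eq_one, ← Finset.mul_sum] at h9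
      have h10 : f * κ * ∑ t ∈ T, w x t * (V (next x t) - V x) ≤ f * κ * -(r / 4) :=
        mul_le_mul_of_nonneg_left hstep (by positivity)
      have h11 : f * κ * (κ * D ^ 2) ≤ f * κ * (r / 8) :=
        mul_le_mul_of_nonneg_left h2 (by positivity)
      nlinarith
    · have h4 : ∑ t ∈ T, w x t * Real.exp (κ * V (next x t)) ≤ K' := by
        refine h.step_le fun t ht hw => Real.exp_le_exp.2 (mul_le_mul_of_nonneg_left ?_ hκ.le)
        linarith [(abs_le.1 (hjump x t ht hw)).2]
      have h5 : κ * r / 8 * Real.exp (κ * V x) ≤ Real.exp (κ * V x) := by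
        have := Real.exp_pos (κ * V x)
        nlinarith
      linarith

end IsStationaryStep

/-! ### One slot of the switch as a finite sum -/

theorem PMF.tsum_bind_mul {X Y : Type*} (p : PMF X) (κ : X → PMF Y) (g : Y → ENNReal) :
    ∑' y, p.bind κ y * g y = ∑' x, p x * ∑' y, κ x y * g y := by
  simp_rw [PMF.bind_apply, ← ENNReal.tsum_mul_right, ← ENNReal.tsum_mul_left]
  rw [ENNReal.tsum_comm]
  simp_rw [mul_assoc]

theorem PMF.tsum_pure_mul {Y : Type*} (y₀ : Y) (g : Y → ENNReal) :
    ∑' y, PMF.pure y₀ y * g y = g y₀ := by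
  rw [tsum_eq_single y₀ fun y hy => by rw [PMF.pure_apply_of_ne _ _ hy, zero_mul]]
  rw [PMF.pure_apply_self, one_mul]

theorem PMF.tsum_mul_ofReal {X : Type*} (p : PMF X) {F : Finset X} (hF : ∀ x ∈ p.support, x ∈ F)
    {f : X → ℝ} (hf : ∀ x, 0 ≤ f x) :
    ∑' x, p x * ENNReal.ofReal (f x) = ENNReal.ofReal (∑ x ∈ F, (p x).toReal * f x) := by
  rw [tsum_eq_sum (s := F) fun x hx => by
      rw [(p.apply_eq_zero_iff x).2 fun h => hx (hF x h), zero_mul],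
    ENNReal.ofReal_sum_of_nonneg fun x _ => mul_nonneg ENNReal.toReal_nonneg (hf x)]
  refine Finset.sum_congr rfl fun x _ => ?_
  rw [ENNReal.ofReal_mul ENNReal.toReal_nonneg, ENNReal.ofReal_toReal (p.apply_ne_top x)]

theorem PMF.sum_toReal_eq_one {X : Type*} (p : PMF X) {F : Finset X}
    (hF : ∀ x ∈ p.support, x ∈ F) : ∑ x ∈ F, (p x).toReal = 1 := by
  have h : ∑' x, p x = ∑ x ∈ F, p x :=
    tsum_eq_sum fun x hx => (p.apply_eq_zero_iff x).2 fun h => hx (hF x h)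
  rw [← ENNReal.toReal_sum fun x _ => p.apply_ne_top x, ← h, p.tsum_coe, ENNReal.toReal_one]

theorem PMF.integrable_of_support_subset {X : Type*} [MeasurableSpace X]
    [DiscreteMeasurableSpace X] (p : PMF X) {F : Finset X} (hF : ∀ x ∈ p.support, x ∈ F)
    (f : X → ℝ) : Integrable f p.toMeasure := by
  refine Integrable.mono' (g := fun _ => ∑ x ∈ F, |f x|) (integrable_const _)
    Measurable.of_discrete.aestronglyMeasurable ?_
  rw [← p.restrict_toMeasure_support]
  refine (ae_restrict_iff' .of_discrete).2 (.of_forall fun x hx => ?_)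
  exact Finset.single_le_sum (f := fun x => |f x|) (fun _ _ => abs_nonneg _) (hF x hx)

theorem PMF.integral_eq_sum_of_support_subset {X : Type*} [MeasurableSpace X]
    [DiscreteMeasurableSpace X] (p : PMF X) {F : Finset X} (hF : ∀ x ∈ p.support, x ∈ F)
    (f : X → ℝ) : ∫ x, f x ∂p.toMeasure = ∑ x ∈ F, (p x).toReal * f x := by
  rw [PMF.integral_eq_tsum p f (p.integrable_of_support_subset hF f),
    tsum_eq_sum (s := F) fun x hx => by
      rw [(p.apply_eq_zero_iff x).2 fun h => hx (hF x h), ENNReal.toReal_zero, zero_smul]]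
  rfl

namespace GenSwitch

variable {n L : ℕ} {M : Type*} [Fintype M]

/-- The arrival vectors with all coordinates at most `Amax`. -/
def arrivalBox (n Amax : ℕ) : Finset (Fin n → ℕ) :=
  Fintype.piFinset fun _ => Finset.range (Amax + 1)

theorem mem_arrivalBox {Amax : ℕ} {a : Fin n → ℕ} :
    a ∈ arrivalBox n Amax ↔ ∀ i, a i ≤ Amax := by
  simp [arrivalBox]

/-- All service vectors that are feasible in some channel state. -/
def services (G : GenSwitch n L M) : Finset (Fin n → ℕ) := Finset.univ.biUnion G.S

theorem mem_services (G : GenSwitch n L M) {m : M} {s : Fin n → ℕ} (hs : s ∈ G.S m) :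
    s ∈ G.services :=
  Finset.mem_biUnion.2 ⟨m, Finset.mem_univ m, hs⟩

/-- The triples of channel state, service vector and arrival vector that one slot can produce. -/
def outcomes (G : GenSwitch n L M) (Amax : ℕ) : Finset (M × (Fin n → ℕ) × (Fin n → ℕ)) :=
  Finset.univ ×ˢ G.services ×ˢ arrivalBox n Amax

/-- The probability of the triple of channel state, service vector and arrival vector in a slot
that starts from queue lengths `q`. -/
noncomputable def weight (G : GenSwitch n L M) (α : PMF (Fin n → ℕ))
    (σ : (Fin n → ℕ) → M → PMF (Fin n → ℕ)) (q : Fin n → ℕ)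
    (t : M × (Fin n → ℕ) × (Fin n → ℕ)) : ℝ :=
  (G.ψ t.1).toReal * ((σ q t.1 t.2.1).toReal * (α t.2.2).toReal)

/-- The conditional mean, given the queue lengths `q`, of a function of the channel state, the
service vector and the arrival vector of the slot. -/
noncomputable def slotMean (G : GenSwitch n L M) (Amax : ℕ) (α : PMF (Fin n → ℕ))
    (σ : (Fin n → ℕ) → M → PMF (Fin n → ℕ)) (q : Fin n → ℕ)
    (f : M × (Fin n → ℕ) × (Fin n → ℕ) → ℝ) : ℝ :=
  ∑ t ∈ G.outcomes Amax, G.weight α σ q t * f t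

/-- The triple `t` can occur in a slot that starts from queue lengths `q`. -/
structure Feasible (G : GenSwitch n L M) (Amax : ℕ) (σ : (Fin n → ℕ) → M → PMF (Fin n → ℕ))
    (q : Fin n → ℕ) (t : M × (Fin n → ℕ) × (Fin n → ℕ)) : Prop where
  state_pos : G.ψ t.1 ≠ 0
  selected : t.2.1 ∈ (σ q t.1).support
  service_mem : t.2.1 ∈ G.S t.1
  arrival_le : ∀ i, t.2.2 i ≤ Amax

/-- The queue lengths at the end of a slot, as a function of the outcome of the slot. -/
def next (q : Fin n → ℕ) (t : M × (Fin n → ℕ) × (Fin n → ℕ)) : Fin n → ℕ :=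
  nextQueue q t.2.2 t.2.1

section Slot

variable {G : GenSwitch n L M} {Amax : ℕ} {α : PMF (Fin n → ℕ)}
  {σ : (Fin n → ℕ) → M → PMF (Fin n → ℕ)} {q : Fin n → ℕ}

theorem slotMean_eq (f : M × (Fin n → ℕ) × (Fin n → ℕ) → ℝ) :
    G.slotMean Amax α σ q f = ∑ m, (G.ψ m).toReal * ∑ s ∈ G.services, (σ q m s).toReal *
      ∑ a ∈ arrivalBox n Amax, (α a).toReal * f (m, s, a) := by
  simp only [slotMean, outcomes, weight, Finset.sum_product, Finset.mul_sum, mul_assoc]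

theorem weight_nonneg (t : M × (Fin n → ℕ) × (Fin n → ℕ)) : 0 ≤ G.weight α σ q t := by
  unfold weight; positivity

theorem feasible_of_weight_ne_zero (hσ : G.IsPolicy σ) (hα : ∀ a ∈ α.support, ∀ i, a i ≤ Amax)
    {t : M × (Fin n → ℕ) × (Fin n → ℕ)} (h : G.weight α σ q t ≠ 0) : G.Feasible Amax σ q t := by
  unfold weight at h
  have h1 : G.ψ t.1 ≠ 0 := fun h0 => h (by simp [h0])
  have h2 : σ q t.1 t.2.1 ≠ 0 := fun h0 => h (by simp [h0])
  have h3 : α t.2.2 ≠ 0 := fun h0 => h (by simp [h0])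
  exact ⟨h1, h2, hσ _ _ _ h2, hα _ h3⟩

theorem sum_channel : ∑ m, (G.ψ m).toReal = 1 :=
  G.ψ.sum_toReal_eq_one fun _ _ => Finset.mem_univ _

theorem sum_policy (hσ : G.IsPolicy σ) (m : M) : ∑ s ∈ G.services, (σ q m s).toReal = 1 :=
  (σ q m).sum_toReal_eq_one fun s hs => G.mem_services (hσ q m s hs)

theorem sum_arrival (hα : ∀ a ∈ α.support, ∀ i, a i ≤ Amax) :
    ∑ a ∈ arrivalBox n Amax, (α a).toReal = 1 :=
  α.sum_toReal_eq_one fun a ha => mem_arrivalBox.2 (hα a ha)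

theorem slotMean_state_arrival (hσ : G.IsPolicy σ) (f : M → (Fin n → ℕ) → ℝ) :
    G.slotMean Amax α σ q (fun t => f t.1 t.2.2) =
      ∑ m, (G.ψ m).toReal * ∑ a ∈ arrivalBox n Amax, (α a).toReal * f m a := by
  rw [slotMean_eq]
  refine Finset.sum_congr rfl fun m _ => ?_
  dsimp only
  rw [← Finset.sum_mul, sum_policy hσ, one_mul]

theorem slotMean_arrival (hσ : G.IsPolicy σ) (f : (Fin n → ℕ) → ℝ) :
    G.slotMean Amax α σ q (fun t => f t.2.2) =
      ∑ a ∈ arrivalBox n Amax, (α a).toReal * f a := by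
  rw [slotMean_state_arrival hσ fun _ a => f a, ← Finset.sum_mul, sum_channel, one_mul]

theorem slotMean_state (hσ : G.IsPolicy σ) (hα : ∀ a ∈ α.support, ∀ i, a i ≤ Amax) (f : M → ℝ) :
    G.slotMean Amax α σ q (fun t => f t.1) = ∑ m, (G.ψ m).toReal * f m := by
  rw [slotMean_state_arrival hσ fun m _ => f m]
  refine Finset.sum_congr rfl fun m _ => ?_
  rw [← Finset.sum_mul, sum_arrival hα, one_mul]

theorem slotMean_const (hσ : G.IsPolicy σ) (hα : ∀ a ∈ α.support, ∀ i, a i ≤ Amax) (r : ℝ) :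
    G.slotMean Amax α σ q (fun _ => r) = r := by
  rw [slotMean_state hσ hα fun _ => r, ← Finset.sum_mul, sum_channel, one_mul]

theorem slotMean_add (f g : M × (Fin n → ℕ) × (Fin n → ℕ) → ℝ) :
    G.slotMean Amax α σ q (fun t => f t + g t) =
      G.slotMean Amax α σ q f + G.slotMean Amax α σ q g := by
  simp only [slotMean, mul_add, Finset.sum_add_distrib]

theorem slotMean_sub (f g : M × (Fin n → ℕ) × (Fin n → ℕ) → ℝ) :
    G.slotMean Amax α σ q (fun t => f t - g t) =
      G.slotMean Amax α σ q f - G.slotMean Amax α σ q g := by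
  simp only [slotMean, mul_sub, Finset.sum_sub_distrib]

theorem slotMean_const_mul (r : ℝ) (f : M × (Fin n → ℕ) × (Fin n → ℕ) → ℝ) :
    G.slotMean Amax α σ q (fun t => r * f t) = r * G.slotMean Amax α σ q f := by
  simp only [slotMean, Finset.mul_sum]
  exact Finset.sum_congr rfl fun t _ => by ring

theorem slotMean_mono (hσ : G.IsPolicy σ) (hα : ∀ a ∈ α.support, ∀ i, a i ≤ Amax)
    {f g : M × (Fin n → ℕ) × (Fin n → ℕ) → ℝ} (h : ∀ t, G.Feasible Amax σ q t → f t ≤ g t) :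
    G.slotMean Amax α σ q f ≤ G.slotMean Amax α σ q g := by
  refine Finset.sum_le_sum fun t _ => ?_
  by_cases hw : G.weight α σ q t = 0
  · simp [hw]
  · exact mul_le_mul_of_nonneg_left (h t (feasible_of_weight_ne_zero hσ hα hw)) (weight_nonneg t)

/-- The mean of `f` under the law `step` of the next queue lengths is a finite sum. -/
theorem tsum_step_mul_ofReal (hσ : G.IsPolicy σ) (hα : ∀ a ∈ α.support, ∀ i, a i ≤ Amax)
    {f : (Fin n → ℕ) → ℝ} (hf : ∀ x, 0 ≤ f x) :
    ∑' x, G.step α σ q x * ENNReal.ofReal (f x) =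
      ENNReal.ofReal (G.slotMean Amax α σ q fun t => f (next q t)) := by
  simp only [step, PMF.tsum_bind_mul, PMF.tsum_pure_mul]
  rw [slotMean_eq, ← PMF.tsum_mul_ofReal (F := Finset.univ) _ (fun _ _ => Finset.mem_univ _)
    fun m => Finset.sum_nonneg fun s _ => mul_nonneg ENNReal.toReal_nonneg
      (Finset.sum_nonneg fun a _ => mul_nonneg ENNReal.toReal_nonneg (hf _))]
  congr 1 with m
  congr 1
  rw [← PMF.tsum_mul_ofReal (F := G.services) _ (fun s hs => G.mem_services (hσ q m s hs))
    fun s => Finset.sum_nonneg fun a _ => mul_nonneg ENNReal.toReal_nonneg (hf _)]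
  congr 1 with s
  congr 1
  rw [← PMF.tsum_mul_ofReal _ (fun a ha => mem_arrivalBox.2 (hα a ha)) fun a => hf _]
  rfl

theorem IsSteadyState.isStationaryStep {π : PMF (Fin n → ℕ)} (hπ : G.IsSteadyState α σ π)
    (hσ : G.IsPolicy σ) (hα : ∀ a ∈ α.support, ∀ i, a i ≤ Amax) :
    IsStationaryStep π.toMeasure (G.outcomes Amax) (G.weight α σ) next where
  nonneg _ t _ := weight_nonneg t
  sum_eq_one q := by simpa [slotMean] using slotMean_const (q := q) hσ hα 1
  integral_eq f N hf hN := by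
    have h0 : ∀ q, 0 ≤ G.slotMean Amax α σ q fun t => f (next q t) := fun q =>
      Finset.sum_nonneg fun t _ => mul_nonneg (weight_nonneg t) (hf _)
    have hπ' : π.bind (G.step α σ) = π := hπ
    have key : ∑' x, π x * ENNReal.ofReal (f x) =
        ∑' q, π q * ENNReal.ofReal (G.slotMean Amax α σ q fun t => f (next q t)) := by
      conv_lhs => rw [← hπ', PMF.tsum_bind_mul]
      simp only [tsum_step_mul_ofReal hσ hα hf]
    change ∫ q, G.slotMean Amax α σ q (fun t => f (next q t)) ∂π.toMeasure = _
    rw [integral_eq_lintegral_of_nonneg_ae (.of_forall hf)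
        Measurable.of_discrete.aestronglyMeasurable,
      integral_eq_lintegral_of_nonneg_ae (.of_forall h0)
        Measurable.of_discrete.aestronglyMeasurable, lintegral_countable', lintegral_countable']
    simp only [PMF.toMeasure_apply_singleton _ _ (measurableSet_singleton _)]
    simp only [mul_comm _ (π _)]
    rw [key]

end Slot

end GenSwitch

/-! ### The weighted queue length and the lost service -/

namespace GenSwitch

variable {n L : ℕ} {M : Type*} [Fintype M]

/-- The queue lengths weighted with the normal vector of the `l`-th face. -/
def weightedQueue (G : GenSwitch n L M) (l : Fin L) (q : Fin n → ℕ) : ℝ := toRealVec q ⬝ᵥ G.c l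

/-- The lost service of a slot: the amount by which the `c l`-weighted work that is really done
falls short of the maximum `maxService`. It consists of the loss due to a schedule that does not
maximize the `c l`-weighted service and of the weighted unused service. -/
noncomputable def lostService (G : GenSwitch n L M) (l : Fin L) (q : Fin n → ℕ)
    (t : M × (Fin n → ℕ) × (Fin n → ℕ)) : ℝ :=
  (G.maxService t.1 l - G.c l ⬝ᵥ toRealVec t.2.1) +
    G.c l ⬝ᵥ toRealVec (unusedService q t.2.2 t.2.1)

section Basic

variable (G : GenSwitch n L M) (l : Fin L)

theorem dotProduct_toRealVec_nonneg (x : Fin n → ℕ) : 0 ≤ G.c l ⬝ᵥ toRealVec x :=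
  Finset.sum_nonneg fun i _ => mul_nonneg (G.c_nonneg l i) (Nat.cast_nonneg _)

theorem weightedQueue_nonneg (q : Fin n → ℕ) : 0 ≤ G.weightedQueue l q := by
  rw [weightedQueue, dotProduct_comm]; exact G.dotProduct_toRealVec_nonneg l q

theorem le_maxService {m : M} {s : Fin n → ℕ} (hs : s ∈ G.S m) :
    G.c l ⬝ᵥ toRealVec s ≤ G.maxService m l :=
  Finset.le_sup' (fun s => G.c l ⬝ᵥ toRealVec s) hs

theorem exists_eq_maxService (m : M) : ∃ s ∈ G.S m, G.c l ⬝ᵥ toRealVec s = G.maxService m l := by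
  obtain ⟨s, hs, h⟩ :=
    Finset.exists_mem_eq_sup' (G.S_nonempty m) fun s => G.c l ⬝ᵥ toRealVec s
  exact ⟨s, hs, h.symm⟩

theorem maxService_nonneg (m : M) : 0 ≤ G.maxService m l := by
  obtain ⟨s, -, h⟩ := G.exists_eq_maxService l m
  rw [← h]; exact G.dotProduct_toRealVec_nonneg l s

theorem maxService_le_bMax (m : M) : G.maxService m l ≤ G.bMax :=
  le_ciSup (f := fun p : M × Fin L => G.maxService p.1 p.2) (Set.finite_range _).bddAbove (m, l)

omit [Fintype M] in
theorem toRealVec_next (q : Fin n → ℕ) (t : M × (Fin n → ℕ) × (Fin n → ℕ)) :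
    toRealVec (next q t) = toRealVec q + toRealVec t.2.2 - toRealVec t.2.1 +
      toRealVec (unusedService q t.2.2 t.2.1) := by
  ext i
  have := (nextQueue_spec q t.2.2 t.2.1 i).1
  simp only [toRealVec, next, Pi.add_apply, Pi.sub_apply]
  have h : (nextQueue q t.2.2 t.2.1 i : ℝ) + t.2.1 i =
      q i + t.2.2 i + unusedService q t.2.2 t.2.1 i := by exact_mod_cast this
  linarith

/-- The weighted queue length follows a scalar Lindley-type recursion in which the lost service
plays the role of the unused service. -/
theorem weightedQueue_next (q : Fin n → ℕ) (t : M × (Fin n → ℕ) × (Fin n → ℕ)) :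
    G.weightedQueue l (next q t) = G.weightedQueue l q +
      (G.c l ⬝ᵥ toRealVec t.2.2 - G.maxService t.1 l) + G.lostService l q t := by
  simp only [weightedQueue, lostService, toRealVec_next, dotProduct_comm _ (G.c l), dotProduct_add,
    dotProduct_sub]
  ring

variable {G l} in
theorem lostService_nonneg {q : Fin n → ℕ} {t : M × (Fin n → ℕ) × (Fin n → ℕ)}
    (ht : t.2.1 ∈ G.S t.1) : 0 ≤ G.lostService l q t :=
  add_nonneg (sub_nonneg.2 (G.le_maxService l ht)) (G.dotProduct_toRealVec_nonneg l _)

theorem lostService_le_maxService (q : Fin n → ℕ) (t : M × (Fin n → ℕ) × (Fin n → ℕ)) :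
    G.lostService l q t ≤ G.maxService t.1 l := by
  have : G.c l ⬝ᵥ toRealVec (unusedService q t.2.2 t.2.1) ≤ G.c l ⬝ᵥ toRealVec t.2.1 :=
    Finset.sum_le_sum fun i _ => mul_le_mul_of_nonneg_left
      (Nat.cast_le.2 (Nat.sub_le _ _)) (G.c_nonneg l i)
  unfold lostService; linarith

theorem lostService_le_bMax (q : Fin n → ℕ) (t : M × (Fin n → ℕ) × (Fin n → ℕ)) :
    G.lostService l q t ≤ G.bMax :=
  (G.lostService_le_maxService l q t).trans (G.maxService_le_bMax l t.1)

omit l in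
theorem exists_dotProduct_ge_of_mem_convexHull {m : M} {y : Fin n → ℝ}
    (hy : y ∈ convexHull ℝ (toRealVec '' (G.S m : Set (Fin n → ℕ)))) (v : Fin n → ℝ) :
    ∃ s ∈ G.S m, v ⬝ᵥ y ≤ v ⬝ᵥ toRealVec s := by
  obtain ⟨_, ⟨s, hs, rfl⟩, h⟩ := (((dotProductBilin ℝ ℝ v).convexOn convex_univ)
    ).exists_ge_of_mem_convexHull (Set.subset_univ _) hy
  exact ⟨s, hs, h⟩

omit l in
theorem nonneg_of_mem_convexHull {m : M} {y : Fin n → ℝ}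
    (hy : y ∈ convexHull ℝ (toRealVec '' (G.S m : Set (Fin n → ℕ)))) (i : Fin n) : 0 ≤ y i := by
  obtain ⟨s, -, h⟩ := G.exists_dotProduct_ge_of_mem_convexHull hy (-Pi.single i 1)
  simp only [neg_dotProduct, single_dotProduct, one_mul] at h
  have : (0 : ℝ) ≤ toRealVec s i := Nat.cast_nonneg _
  linarith

variable {G l} in
/-- A face is nonempty only if its level is the mean of the maximal weighted services: the support
function of a weighted Minkowski sum is the weighted sum of the support functions. -/
theorem meanB_eq {ν : Fin n → ℝ} (hν : ν ∈ G.face l) : G.meanB l = G.b l := by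
  obtain ⟨⟨y, hy, hνy⟩, hb⟩ := hν
  apply le_antisymm
  · choose s hs hsm using G.exists_eq_maxService l
    have hmem : (∑ m, (G.ψ m).toReal • toRealVec (s m)) ∈ capacityRegion G.ψ G.S :=
      ⟨fun m => toRealVec (s m), fun m => subset_convexHull ℝ _ ⟨s m, hs m, rfl⟩, rfl⟩
    rw [G.capacity_eq] at hmem
    have := hmem.2 l
    rw [dotProduct_sum] at this
    simpa only [meanB, dotProduct_smul, hsm, smul_eq_mul] using this
  · rw [← hb, hνy, dotProduct_sum]
    refine Finset.sum_le_sum fun m _ => ?_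
    rw [dotProduct_smul, smul_eq_mul]
    refine mul_le_mul_of_nonneg_left ?_ ENNReal.toReal_nonneg
    obtain ⟨s, hs, h⟩ := G.exists_dotProduct_ge_of_mem_convexHull (hy m) (G.c l)
    exact h.trans (G.le_maxService l hs)

end Basic

section Moments

variable {G : GenSwitch n L M} {l : Fin L} {Amax : ℕ} {α : PMF (Fin n → ℕ)}
  {σ : (Fin n → ℕ) → M → PMF (Fin n → ℕ)} {q : Fin n → ℕ} {lam : Fin n → ℝ}

theorem IsArrivalLaw.integral_eq (hα : IsArrivalLaw lam Amax α) (f : (Fin n → ℕ) → ℝ) :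
    ∫ a, f a ∂α.toMeasure = ∑ a ∈ arrivalBox n Amax, (α a).toReal * f a :=
  α.integral_eq_sum_of_support_subset (fun a ha => mem_arrivalBox.2 (hα.1 a ha)) f

theorem IsArrivalLaw.sum_apply (hα : IsArrivalLaw lam Amax α) (i : Fin n) :
    ∑ a ∈ arrivalBox n Amax, (α a).toReal * (a i : ℝ) = lam i := by
  rw [← hα.2 i, hα.integral_eq]

theorem IsArrivalLaw.sum_dotProduct (hα : IsArrivalLaw lam Amax α) (v : Fin n → ℝ) :
    ∑ a ∈ arrivalBox n Amax, (α a).toReal * (v ⬝ᵥ toRealVec a) = v ⬝ᵥ lam := by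
  simp only [dotProduct, Finset.mul_sum]
  rw [Finset.sum_comm]
  refine Finset.sum_congr rfl fun i _ => ?_
  rw [← hα.sum_apply i, Finset.mul_sum]
  exact Finset.sum_congr rfl fun a _ => by simp only [toRealVec]; ring

theorem IsArrivalLaw.sum_sq_dotProduct (hα : IsArrivalLaw lam Amax α) (v : Fin n → ℝ) :
    ∑ a ∈ arrivalBox n Amax, (α a).toReal * (v ⬝ᵥ toRealVec a - v ⬝ᵥ lam) ^ 2 =
      v ⬝ᵥ (arrivalCov α *ᵥ v) := by
  have hcov : ∀ i j, arrivalCov α i j =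
      ∑ a ∈ arrivalBox n Amax, (α a).toReal * (((a i : ℝ) - lam i) * ((a j : ℝ) - lam j)) := by
    intro i j
    simp only [arrivalCov, Matrix.of_apply, covariance, hα.2]
    rw [hα.integral_eq]
  have hsq : ∀ a : Fin n → ℕ, (v ⬝ᵥ toRealVec a - v ⬝ᵥ lam) ^ 2 =
      ∑ i, ∑ j, v i * ((((a i : ℝ) - lam i) * ((a j : ℝ) - lam j)) * v j) := by
    intro a
    rw [← dotProduct_sub, sq, dotProduct, Finset.sum_mul_sum]
    refine Finset.sum_congr rfl fun i _ => Finset.sum_congr rfl fun j _ => ?_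
    simp only [toRealVec, Pi.sub_apply]; ring
  simp only [hsq]
  simp only [dotProduct, Matrix.mulVec, hcov, Finset.mul_sum, Finset.sum_mul]
  rw [Finset.sum_comm]
  refine Finset.sum_congr rfl fun i _ => ?_
  rw [Finset.sum_comm]
  exact Finset.sum_congr rfl fun j _ => Finset.sum_congr rfl fun a _ => by ring

theorem slotMean_arrival_dotProduct (hσ : G.IsPolicy σ) (hα : IsArrivalLaw lam Amax α)
    (v : Fin n → ℝ) : G.slotMean Amax α σ q (fun t => v ⬝ᵥ toRealVec t.2.2) = v ⬝ᵥ lam := by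
  rw [slotMean_arrival hσ fun a => v ⬝ᵥ toRealVec a, hα.sum_dotProduct]

theorem slotMean_netInput (hσ : G.IsPolicy σ) (hα : IsArrivalLaw lam Amax α) :
    G.slotMean Amax α σ q (fun t => G.c l ⬝ᵥ toRealVec t.2.2 - G.maxService t.1 l) =
      G.c l ⬝ᵥ lam - G.meanB l := by
  rw [slotMean_sub, slotMean_arrival_dotProduct hσ hα,
    slotMean_state hσ hα.1 fun m => G.maxService m l]
  rfl

theorem slotMean_netInput_sq (hσ : G.IsPolicy σ) (hα : IsArrivalLaw lam Amax α) :
    G.slotMean Amax α σ q (fun t => (G.c l ⬝ᵥ toRealVec t.2.2 - G.maxService t.1 l) ^ 2) =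
      G.c l ⬝ᵥ (arrivalCov α *ᵥ G.c l) + G.varB l + (G.c l ⬝ᵥ lam - G.meanB l) ^ 2 := by
  set d := G.c l ⬝ᵥ lam - G.meanB l with hd
  have h1 : ∀ m, ∑ a ∈ arrivalBox n Amax, (α a).toReal *
      (G.c l ⬝ᵥ toRealVec a - G.maxService m l) ^ 2 =
      G.c l ⬝ᵥ (arrivalCov α *ᵥ G.c l) + (G.c l ⬝ᵥ lam - G.maxService m l) ^ 2 := by
    intro m
    have h2 : ∀ a, (α a).toReal * (G.c l ⬝ᵥ toRealVec a - G.maxService m l) ^ 2 =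
        (α a).toReal * (G.c l ⬝ᵥ toRealVec a - G.c l ⬝ᵥ lam) ^ 2 +
        (α a).toReal * (G.c l ⬝ᵥ toRealVec a) * (2 * (G.c l ⬝ᵥ lam - G.maxService m l)) +
        (α a).toReal * ((G.c l ⬝ᵥ lam - G.maxService m l) ^ 2 -
          2 * (G.c l ⬝ᵥ lam) * (G.c l ⬝ᵥ lam - G.maxService m l)) := fun a => by ring
    simp only [h2, Finset.sum_add_distrib, ← Finset.sum_mul, sum_arrival hα.1,
      hα.sum_dotProduct, hα.sum_sq_dotProduct]
    ring
  rw [slotMean_state_arrival hσ fun m a => (G.c l ⬝ᵥ toRealVec a - G.maxService m l) ^ 2]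
  simp only [h1]
  have h3 : ∀ m, (G.ψ m).toReal * (G.c l ⬝ᵥ (arrivalCov α *ᵥ G.c l) +
      (G.c l ⬝ᵥ lam - G.maxService m l) ^ 2) =
      (G.ψ m).toReal * (G.c l ⬝ᵥ (arrivalCov α *ᵥ G.c l) + d ^ 2 + 2 * d * G.meanB l) +
      (G.ψ m).toReal * (G.maxService m l - G.meanB l) ^ 2 -
      (G.ψ m).toReal * G.maxService m l * (2 * d) := fun m => by rw [hd]; ring
  simp only [h3, Finset.sum_sub_distrib, Finset.sum_add_distrib, ← Finset.sum_mul, sum_channel]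
  change _ + G.varB l - G.meanB l * _ = _
  ring

theorem slotMean_weightedQueue_diff (hσ : G.IsPolicy σ) (hα : IsArrivalLaw lam Amax α) :
    G.slotMean Amax α σ q (fun t => G.weightedQueue l (next q t) - G.weightedQueue l q) =
      G.c l ⬝ᵥ lam - G.meanB l + G.slotMean Amax α σ q (G.lostService l q) := by
  rw [← slotMean_netInput (q := q) hσ hα, ← slotMean_add]
  congr 1 with t
  rw [weightedQueue_next]; ring

theorem slotMean_weightedQueue_sq_diff (hσ : G.IsPolicy σ) (hα : IsArrivalLaw lam Amax α) :
    G.slotMean Amax α σ q (fun t => G.weightedQueue l (next q t) ^ 2 - G.weightedQueue l q ^ 2) =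
      2 * G.weightedQueue l q * (G.c l ⬝ᵥ lam - G.meanB l) +
      (G.c l ⬝ᵥ (arrivalCov α *ᵥ G.c l) + G.varB l + (G.c l ⬝ᵥ lam - G.meanB l) ^ 2) +
      G.slotMean Amax α σ q (fun t => 2 * G.weightedQueue l (next q t) * G.lostService l q t -
        G.lostService l q t ^ 2) := by
  rw [← slotMean_netInput_sq (q := q) hσ hα, ← slotMean_netInput (q := q) hσ hα,
    ← slotMean_const_mul, ← slotMean_add, ← slotMean_add]
  congr 1 with t
  rw [weightedQueue_next]; ring

end Moments

end GenSwitch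

/-! ### Steady-state identities and the universal lower bound -/

namespace GenSwitch

variable {n L : ℕ} {M : Type*} [Fintype M] {G : GenSwitch n L M} {l : Fin L} {Amax : ℕ}
  {α : PMF (Fin n → ℕ)} {σ : (Fin n → ℕ) → M → PMF (Fin n → ℕ)} {π : PMF (Fin n → ℕ)}
  {lam : Fin n → ℝ} {q : Fin n → ℕ}

theorem slotMean_le (hσ : G.IsPolicy σ) (hα : ∀ a ∈ α.support, ∀ i, a i ≤ Amax)
    {f : M × (Fin n → ℕ) × (Fin n → ℕ) → ℝ} {r : ℝ} (h : ∀ t, G.Feasible Amax σ q t → f t ≤ r) :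
    G.slotMean Amax α σ q f ≤ r :=
  (slotMean_mono hσ hα h).trans_eq (slotMean_const hσ hα r)

theorem le_slotMean (hσ : G.IsPolicy σ) (hα : ∀ a ∈ α.support, ∀ i, a i ≤ Amax)
    {f : M × (Fin n → ℕ) × (Fin n → ℕ) → ℝ} {r : ℝ} (h : ∀ t, G.Feasible Amax σ q t → r ≤ f t) :
    r ≤ G.slotMean Amax α σ q f :=
  (slotMean_const hσ hα r).symm.le.trans (slotMean_mono hσ hα h)

theorem abs_slotMean_le (hσ : G.IsPolicy σ) (hα : ∀ a ∈ α.support, ∀ i, a i ≤ Amax)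
    {f : M × (Fin n → ℕ) × (Fin n → ℕ) → ℝ} {r : ℝ}
    (h : ∀ t, G.Feasible Amax σ q t → |f t| ≤ r) : |G.slotMean Amax α σ q f| ≤ r :=
  abs_le.2 ⟨le_slotMean hσ hα fun t ht => (abs_le.1 (h t ht)).1,
    slotMean_le hσ hα fun t ht => (abs_le.1 (h t ht)).2⟩

theorem bMax_nonneg_of_face (l : Fin L) (m : M) : 0 ≤ G.bMax :=
  (G.maxService_nonneg l m).trans (G.maxService_le_bMax l m)

/-- A bound on the change of the weighted queue length in one slot. -/
noncomputable def weightedJump (G : GenSwitch n L M) (l : Fin L) (Amax : ℕ) : ℝ :=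
  ∑ i, G.c l i * Amax + G.bMax

theorem Feasible.abs_weightedQueue_sub_le {t : M × (Fin n → ℕ) × (Fin n → ℕ)}
    (ht : G.Feasible Amax σ q t) :
    |G.weightedQueue l (next q t) - G.weightedQueue l q| ≤ G.weightedJump l Amax := by
  have hA : G.c l ⬝ᵥ toRealVec t.2.2 ≤ ∑ i, G.c l i * Amax :=
    Finset.sum_le_sum fun i _ => mul_le_mul_of_nonneg_left (Nat.cast_le.2 (ht.arrival_le i))
      (G.c_nonneg l i)
  have hA0 := G.dotProduct_toRealVec_nonneg l t.2.2
  have hU := lostService_nonneg (l := l) (q := q) ht.service_mem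
  have hU' := G.lostService_le_maxService l q t
  have hB := G.maxService_le_bMax l t.1
  rw [weightedQueue_next, abs_le]
  unfold weightedJump
  constructor <;> linarith

theorem integrable_slotMean (hσ : G.IsPolicy σ) (hα : ∀ a ∈ α.support, ∀ i, a i ≤ Amax)
    {f : (Fin n → ℕ) → M × (Fin n → ℕ) × (Fin n → ℕ) → ℝ} {h : (Fin n → ℕ) → ℝ}
    (hh : Integrable h π.toMeasure) (hf : ∀ q t, G.Feasible Amax σ q t → |f q t| ≤ h q) :
    Integrable (fun q => G.slotMean Amax α σ q (f q)) π.toMeasure :=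
  IsStationaryStep.integrable_of_abs_le hh fun q => abs_slotMean_le hσ hα (hf q)

theorem integrable_slotMean_lostService (hσ : G.IsPolicy σ)
    (hα : ∀ a ∈ α.support, ∀ i, a i ≤ Amax) :
    Integrable (fun q => G.slotMean Amax α σ q (G.lostService l q)) π.toMeasure :=
  integrable_slotMean hσ hα (integrable_const G.bMax) fun q t ht => by
    rw [abs_of_nonneg (lostService_nonneg ht.service_mem)]
    exact G.lostService_le_bMax l q t

/-- In steady state the mean lost service equals the spare capacity. -/
theorem IsSteadyState.integral_lostService (hπ : G.IsSteadyState α σ π) (hσ : G.IsPolicy σ)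
    (hα : IsArrivalLaw lam Amax α) :
    ∫ q, G.slotMean Amax α σ q (G.lostService l q) ∂π.toMeasure =
      G.meanB l - G.c l ⬝ᵥ lam := by
  have h := (hπ.isStationaryStep hσ hα.1).integral_drift_eq_zero (f := G.weightedQueue l)
    (G.weightedQueue_nonneg l) (integrable_const (G.weightedJump l Amax)) fun q t _ hw =>
      (feasible_of_weight_ne_zero hσ hα.1 hw).abs_weightedQueue_sub_le
  change ∫ q, G.slotMean Amax α σ q
    (fun t => G.weightedQueue l (next q t) - G.weightedQueue l q) ∂π.toMeasure = 0 at h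
  simp only [slotMean_weightedQueue_diff hσ hα] at h
  rw [integral_add (integrable_const _) (integrable_slotMean_lostService hσ hα.1)] at h
  simp only [integral_const, probReal_univ, one_smul] at h
  linarith

theorem integrable_slotMean_next_mul_lostService (hσ : G.IsPolicy σ)
    (hα : ∀ a ∈ α.support, ∀ i, a i ≤ Amax) (hfin : G.FiniteMean l π) :
    Integrable (fun q => G.slotMean Amax α σ q
      (fun t => G.weightedQueue l (next q t) * G.lostService l q t)) π.toMeasure := by
  have hi : Integrable (fun q => (G.weightedQueue l q + G.weightedJump l Amax) * G.bMax)
      π.toMeasure :=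
    (Integrable.add hfin (integrable_const (G.weightedJump l Amax))).mul_const G.bMax
  refine integrable_slotMean hσ hα hi fun q t ht => ?_
  have h1 := lostService_nonneg (l := l) (q := q) ht.service_mem
  have h2 := G.weightedQueue_nonneg l (next q t)
  rw [abs_of_nonneg (mul_nonneg h2 h1)]
  have h3 := (abs_le.1 (ht.abs_weightedQueue_sub_le (l := l))).2
  exact mul_le_mul (by linarith) (G.lostService_le_bMax l q t) h1 (by linarith)

theorem integrable_slotMean_lostService_sq (hσ : G.IsPolicy σ)
    (hα : ∀ a ∈ α.support, ∀ i, a i ≤ Amax) :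
    Integrable (fun q => G.slotMean Amax α σ q (fun t => G.lostService l q t ^ 2))
      π.toMeasure :=
  integrable_slotMean hσ hα (integrable_const (G.bMax ^ 2)) fun q t ht => by
    have := lostService_nonneg (l := l) (q := q) ht.service_mem
    rw [abs_of_nonneg (by positivity)]
    gcongr
    exact G.lostService_le_bMax l q t

/-- The steady-state identity obtained from the zero mean drift of the squared weighted queue
length. A finite mean suffices: the increments of the square are dominated by a multiple of the
weighted queue length, so no second moment is needed. -/
theorem IsSteadyState.mean_identity (hπ : G.IsSteadyState α σ π) (hσ : G.IsPolicy σ)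
    (hα : IsArrivalLaw lam Amax α) (hfin : G.FiniteMean l π) :
    2 * (G.meanB l - G.c l ⬝ᵥ lam) * G.meanQueue l π =
      G.c l ⬝ᵥ (arrivalCov α *ᵥ G.c l) + G.varB l + (G.c l ⬝ᵥ lam - G.meanB l) ^ 2 +
      2 * ∫ q, G.slotMean Amax α σ q
        (fun t => G.weightedQueue l (next q t) * G.lostService l q t) ∂π.toMeasure -
      ∫ q, G.slotMean Amax α σ q (fun t => G.lostService l q t ^ 2) ∂π.toMeasure := by
  have hfin' : Integrable (G.weightedQueue l) π.toMeasure := hfin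
  set D := G.weightedJump l Amax with hD
  have hdom : Integrable (fun q => D * (2 * G.weightedQueue l q + D)) π.toMeasure :=
    ((hfin'.const_mul 2).add (integrable_const D)).const_mul D
  have h := (hπ.isStationaryStep hσ hα.1).integral_drift_eq_zero
    (f := fun q => G.weightedQueue l q ^ 2) (fun q => sq_nonneg _) hdom fun q t _ hw => by
      have hj := (feasible_of_weight_ne_zero hσ hα.1 hw).abs_weightedQueue_sub_le (l := l)
      rw [sq_sub_sq, abs_mul, mul_comm]
      have h0 := G.weightedQueue_nonneg l q
      have h1 := G.weightedQueue_nonneg l (next q t)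
      rw [abs_of_nonneg (add_nonneg h1 h0)]
      exact mul_le_mul hj (by linarith [(abs_le.1 hj).2]) (by linarith)
        ((abs_nonneg _).trans hj)
  change ∫ q, G.slotMean Amax α σ q
    (fun t => G.weightedQueue l (next q t) ^ 2 - G.weightedQueue l q ^ 2) ∂π.toMeasure = 0 at h
  have hI1 := integrable_slotMean_next_mul_lostService (π := π) hσ hα.1 hfin
  have hI2 := integrable_slotMean_lostService_sq (l := l) (π := π) hσ hα.1
  simp only [slotMean_weightedQueue_sq_diff hσ hα, slotMean_sub, mul_assoc,
    slotMean_const_mul] at h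
  have hq : Integrable (fun q => 2 * (G.weightedQueue l q * (G.c l ⬝ᵥ lam - G.meanB l)))
      π.toMeasure := (hfin'.mul_const _).const_mul 2
  have hI : Integrable (fun q =>
      2 * G.slotMean Amax α σ q (fun t => G.weightedQueue l (next q t) * G.lostService l q t) -
      G.slotMean Amax α σ q (fun t => G.lostService l q t ^ 2)) π.toMeasure :=
    (hI1.const_mul 2).sub hI2
  rw [integral_add (hq.fun_add (integrable_const _)) hI,
    integral_add hq (integrable_const _), integral_sub (hI1.const_mul 2) hI2,
    integral_const_mul, integral_const_mul, integral_mul_const] at h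
  simp only [integral_const, probReal_univ, one_smul] at h
  change 2 * (G.meanQueue l π * _) + _ + _ = 0 at h
  linarith

theorem dotProduct_arrivalMean {ν : Fin n → ℝ} (hν : ν ∈ G.face l) (ε : ℝ) :
    G.meanB l - G.c l ⬝ᵥ ((1 - ε) • ν) = ε * G.b l := by
  rw [meanB_eq hν, dotProduct_smul, hν.2, smul_eq_mul]; ring

theorem two_mul_ULB {ε : ℝ} (hε : 0 < ε) :
    2 * (ε * G.b l) * G.ULB l α ε = G.c l ⬝ᵥ (arrivalCov α *ᵥ G.c l) + G.varB l -
      ε * G.b l * ((1 - ε) * G.bMax) := by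
  have hb := G.b_pos l
  unfold ULB; field_simp

/-- The lower bound for an arbitrary policy: in `mean_identity`, the mean of `Q⁺ U` is nonnegative
and the mean of `U ^ 2` is at most `bMax * ε * b`. -/
theorem IsSteadyState.universal_lower_bound {ν : Fin n → ℝ} (hν : ν ∈ G.face l) {ε : ℝ}
    (hε : 0 < ε) (hπ : G.IsSteadyState α σ π) (hσ : G.IsPolicy σ)
    (hα : IsArrivalLaw ((1 - ε) • ν) Amax α) (hfin : G.FiniteMean l π) :
    G.ULB l α ε - ε * (G.bMax - G.b l) / 2 ≤ G.meanQueue l π := by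
  have h1 := hπ.mean_identity hσ hα hfin
  have h2 := hπ.integral_lostService (l := l) hσ hα
  have h3 : 0 ≤ ∫ q, G.slotMean Amax α σ q
      (fun t => G.weightedQueue l (next q t) * G.lostService l q t) ∂π.toMeasure :=
    integral_nonneg fun q => le_slotMean hσ hα.1 fun t ht =>
      mul_nonneg (G.weightedQueue_nonneg l _) (lostService_nonneg ht.service_mem)
  have h4 : ∫ q, G.slotMean Amax α σ q (fun t => G.lostService l q t ^ 2) ∂π.toMeasure ≤
      G.bMax * ∫ q, G.slotMean Amax α σ q (G.lostService l q) ∂π.toMeasure := by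
    rw [← integral_const_mul]
    refine integral_mono (integrable_slotMean_lostService_sq hσ hα.1)
      ((integrable_slotMean_lostService hσ hα.1).const_mul _) fun q => ?_
    simp only [← slotMean_const_mul]
    refine slotMean_mono hσ hα.1 fun t ht => ?_
    rw [sq]
    exact mul_le_mul_of_nonneg_right (G.lostService_le_bMax l q t)
      (lostService_nonneg ht.service_mem)
  rw [h2] at h4
  rw [← neg_sub (G.meanB l)] at h1
  rw [dotProduct_arrivalMean hν] at h1 h4
  have h5 : G.ULB l α ε ≤ G.meanQueue l π + ε * (G.bMax - G.b l) / 2 := by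
    have hεb := mul_pos hε (G.b_pos l)
    refine le_of_mul_le_mul_left ?_ (mul_pos two_pos hεb)
    rw [two_mul_ULB hε]
    linarith
  linarith

end GenSwitch

/-! ### Random tie-breaking and the lower bound for MaxWeight -/

theorem Finite.exists_pos_forall_le_zero_or_le {ι : Type*} [Finite ι] (f : ι → ℝ) :
    ∃ δ > 0, ∀ i, f i ≤ 0 ∨ δ ≤ f i := by
  by_cases h : Nonempty {i // 0 < f i}
  · obtain ⟨i₀, h₀⟩ := Finite.exists_min fun i : {i // 0 < f i} => f i
    exact ⟨f i₀, i₀.2, fun i => (le_or_gt (f i) 0).imp_right fun hi => h₀ ⟨i, hi⟩⟩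
  · exact ⟨1, one_pos, fun i => .inl (not_lt.1 fun hi => h ⟨i, hi⟩)⟩

theorem toRealVec_dotProduct_toRealVec {n : ℕ} (x y : Fin n → ℕ) :
    toRealVec x ⬝ᵥ toRealVec y = ((x ⬝ᵥ y : ℕ) : ℝ) := by
  simp [toRealVec, dotProduct]

namespace GenSwitch

variable {n L : ℕ} {M : Type*} [Fintype M] {G : GenSwitch n L M} {l : Fin L} {Amax : ℕ}
  {α : PMF (Fin n → ℕ)} {σ : (Fin n → ℕ) → M → PMF (Fin n → ℕ)} {π : PMF (Fin n → ℕ)}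
  {lam : Fin n → ℝ} {q : Fin n → ℕ} {θ : ℝ}

theorem IsMaxWeight.isPolicy (hσ : G.IsMaxWeight θ σ) : G.IsPolicy σ :=
  fun q m s hs => ((hσ q m).1 s hs).1

theorem mem_argmaxSet_iff {m : M} {s : Fin n → ℕ} : s ∈ G.argmaxSet q m ↔
    s ∈ G.S m ∧ ∀ x ∈ G.S m, toRealVec q ⬝ᵥ toRealVec x ≤ toRealVec q ⬝ᵥ toRealVec s := by
  simp only [argmaxSet, Set.mem_ofPred_eq, toRealVec_dotProduct_toRealVec, Nat.cast_le]

theorem exists_mem_argmaxSet (q : Fin n → ℕ) (m : M) : ∃ s, s ∈ G.argmaxSet q m := by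
  obtain ⟨s, hs, h⟩ := (G.S m).exists_max_image (fun s => q ⬝ᵥ s) (G.S_nonempty m)
  exact ⟨s, hs, h⟩

theorem dotProduct_le_of_mem_argmaxSet {m : M} {s : Fin n → ℕ} (hs : s ∈ G.argmaxSet q m)
    {y : Fin n → ℝ} (hy : y ∈ convexHull ℝ (toRealVec '' (G.S m : Set (Fin n → ℕ)))) :
    toRealVec q ⬝ᵥ y ≤ toRealVec q ⬝ᵥ toRealVec s := by
  obtain ⟨x, hx, h⟩ := G.exists_dotProduct_ge_of_mem_convexHull hy (toRealVec q)
  exact h.trans ((mem_argmaxSet_iff.1 hs).2 x hx)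

/-- MaxWeight can serve the nonempty queues only: if the queues in the set `p` are empty, some
maximizer offers them no service. This holds because the capacity region is closed under lowering
coordinates; the feasible sets themselves need not be. -/
theorem exists_mem_argmaxSet_eq_zero {m : M} (hm : G.ψ m ≠ 0) {p : Fin n → Prop}
    (hp : ∀ i, p i → q i = 0) : ∃ s ∈ G.argmaxSet q m, ∀ i, p i → s i = 0 := by
  classical
  choose s hs using G.exists_mem_argmaxSet q
  have hψ : ∀ m, 0 ≤ (G.ψ m).toReal := fun m => ENNReal.toReal_nonneg
  set x₀ : Fin n → ℝ := ∑ m, (G.ψ m).toReal • toRealVec (s m) with hx₀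
  have hx₀mem : x₀ ∈ capacityRegion G.ψ G.S :=
    ⟨fun m => toRealVec (s m), fun m => subset_convexHull ℝ _ ⟨s m, (hs m).1, rfl⟩, rfl⟩
  set x : Fin n → ℝ := fun i => if p i then 0 else x₀ i with hx
  have hxmem : x ∈ capacityRegion G.ψ G.S := by
    rw [G.capacity_eq] at hx₀mem ⊢
    refine ⟨fun i => ?_, fun l' => le_trans ?_ (hx₀mem.2 l')⟩
    · simp only [hx]; split_ifs
      exacts [le_rfl, hx₀mem.1 i]
    · refine Finset.sum_le_sum fun i _ => mul_le_mul_of_nonneg_left ?_ (G.c_nonneg l' i)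
      simp only [hx]; split_ifs
      exacts [hx₀mem.1 i, le_rfl]
  obtain ⟨y, hy, hxy⟩ := hxmem
  have hqx : toRealVec q ⬝ᵥ x = toRealVec q ⬝ᵥ x₀ := by
    refine Finset.sum_congr rfl fun i _ => ?_
    by_cases hi : p i
    · simp [toRealVec, hp i hi]
    · simp [hx, hi]
  -- Every summand `y m` attains the maximum, since the weighted sums agree.
  have hqy : toRealVec q ⬝ᵥ y m = toRealVec q ⬝ᵥ toRealVec (s m) := by
    rw [hxy, hx₀, dotProduct_sum, dotProduct_sum] at hqx
    simp only [dotProduct_smul, smul_eq_mul] at hqx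
    have := (Finset.sum_eq_sum_iff_of_le fun m _ => mul_le_mul_of_nonneg_left
      (dotProduct_le_of_mem_argmaxSet (hs m) (hy m)) (hψ m)).1 hqx m (Finset.mem_univ m)
    exact mul_left_cancel₀ (ENNReal.toReal_ne_zero.2 ⟨hm, G.ψ.apply_ne_top m⟩) this
  have hyp : ∀ i, p i → y m i = 0 := fun i hi => by
    have h0 : ∑ m, (G.ψ m).toReal * y m i = 0 := by
      have := congrFun hxy i
      simp only [hx, hi, if_true, Finset.sum_apply, Pi.smul_apply, smul_eq_mul] at this
      exact this.symm
    have := (Finset.sum_eq_zero_iff_of_nonneg fun m _ =>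
      mul_nonneg (hψ m) (G.nonneg_of_mem_convexHull (hy m) i)).1 h0 m (Finset.mem_univ m)
    exact (mul_eq_zero.1 this).resolve_left (ENNReal.toReal_ne_zero.2 ⟨hm, G.ψ.apply_ne_top m⟩)
  -- Maximizing a functional that penalizes service to the queues in `p` selects such a maximizer.
  set w : Fin n → ℝ := fun i => if p i then 1 else 0 with hw
  obtain ⟨s', hs', h⟩ := G.exists_dotProduct_ge_of_mem_convexHull (hy m) (toRealVec q - w)
  have hwy : w ⬝ᵥ y m = 0 := Finset.sum_eq_zero fun i _ => by
    by_cases hi : p i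
    · rw [hyp i hi, mul_zero]
    · simp [hw, hi]
  have hws : ∀ i, 0 ≤ w i * toRealVec s' i := fun i => by
    refine mul_nonneg ?_ (Nat.cast_nonneg _)
    simp only [hw]; split_ifs <;> norm_num
  have hws' : 0 ≤ w ⬝ᵥ toRealVec s' := Finset.sum_nonneg fun i _ => hws i
  rw [sub_dotProduct, sub_dotProduct, hwy, hqy] at h
  have hle := (mem_argmaxSet_iff.1 (hs m)).2 s' hs'
  refine ⟨s', mem_argmaxSet_iff.2 ⟨hs', fun x hx => ?_⟩, fun i hi => ?_⟩
  · linarith [(mem_argmaxSet_iff.1 (hs m)).2 x hx]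
  · have h0 : w ⬝ᵥ toRealVec s' = 0 := by linarith
    have := (Finset.sum_eq_zero_iff_of_nonneg fun i _ => hws i).1 h0 i (Finset.mem_univ i)
    simpa [hw, hi, toRealVec] using this

/-- The mean of a nonnegative function is at least the contribution of one channel state and one
schedule. -/
theorem mul_sum_le_slotMean (hσ : G.IsPolicy σ) (hα : ∀ a ∈ α.support, ∀ i, a i ≤ Amax)
    {f : M × (Fin n → ℕ) × (Fin n → ℕ) → ℝ} (hf : ∀ t, G.Feasible Amax σ q t → 0 ≤ f t)
    {m : M} {s : Fin n → ℕ} (hs : s ∈ G.S m) :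
    (G.ψ m).toReal * (σ q m s).toReal *
      ∑ a ∈ arrivalBox n Amax, (α a).toReal * f (m, s, a) ≤ G.slotMean Amax α σ q f := by
  have h : (G.ψ m).toReal * (σ q m s).toReal *
      ∑ a ∈ arrivalBox n Amax, (α a).toReal * f (m, s, a) =
      ∑ t ∈ ({m} : Finset M) ×ˢ ({s} : Finset (Fin n → ℕ)) ×ˢ arrivalBox n Amax,
        G.weight α σ q t * f t := by
    simp only [Finset.sum_product, Finset.sum_singleton, weight, Finset.mul_sum, mul_assoc]
  rw [h]
  refine Finset.sum_le_sum_of_subset_of_nonneg ?_ fun t _ _ => ?_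
  · refine Finset.product_subset_product (Finset.subset_univ _)
      (Finset.product_subset_product ?_ subset_rfl)
    exact Finset.singleton_subset_iff.2 (G.mem_services hs)
  · by_cases hw : G.weight α σ q t = 0
    · simp [hw]
    · exact mul_nonneg (weight_nonneg t) (hf t (feasible_of_weight_ne_zero hσ hα hw))

theorem exists_maxService_pos {ν : Fin n → ℝ} (hν : ν ∈ G.face l) :
    ∃ m, G.ψ m ≠ 0 ∧ 0 < G.maxService m l := by
  by_contra! h
  have : G.meanB l ≤ 0 := Finset.sum_nonpos fun m _ => by
    by_cases hm : G.ψ m = 0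
    · simp [hm]
    · exact mul_nonpos_of_nonneg_of_nonpos ENNReal.toReal_nonneg (h m hm)
  rw [meanB_eq hν] at this
  exact absurd (G.b_pos l) (not_lt.2 this)

/-- The integrand whose mean separates the weighted queue length from the lower bound `ULB`: it
vanishes only if no work is lost, or if the largest possible amount is lost while the weighted
queue length ends up at zero. -/
noncomputable def lossSlack (G : GenSwitch n L M) (l : Fin L) (q : Fin n → ℕ)
    (t : M × (Fin n → ℕ) × (Fin n → ℕ)) : ℝ :=
  G.lostService l q t * (G.bMax - G.lostService l q t) +
    2 * (G.weightedQueue l (next q t) * G.lostService l q t)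

theorem Feasible.lossSlack_ge {t : M × (Fin n → ℕ) × (Fin n → ℕ)}
    (ht : G.Feasible Amax σ q t) :
    2 * (G.weightedQueue l (next q t) * G.lostService l q t) ≤ G.lossSlack l q t := by
  have h1 := lostService_nonneg (l := l) (q := q) ht.service_mem
  have h2 := G.lostService_le_bMax l q t
  unfold lossSlack
  nlinarith [mul_nonneg h1 (sub_nonneg.2 h2)]

theorem exists_weightedQueue_gap (G : GenSwitch n L M) (l : Fin L) :
    ∃ δ > 0, (∀ i, G.c l i ≤ 0 ∨ δ ≤ G.c l i) ∧
      ∀ q, (∀ i, 0 < G.c l i → q i = 0) ∨ δ ≤ G.weightedQueue l q := by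
  obtain ⟨δ, hδ, h⟩ := Finite.exists_pos_forall_le_zero_or_le (G.c l)
  refine ⟨δ, hδ, h, fun q => ?_⟩
  by_cases hq : ∀ i, 0 < G.c l i → q i = 0
  · exact .inl hq
  · right
    push Not at hq
    obtain ⟨i, hi, hqi⟩ := hq
    have h1 : δ ≤ G.c l i := (h i).resolve_left (not_le.2 hi)
    have h2 : (1 : ℝ) ≤ q i := by exact_mod_cast Nat.one_le_iff_ne_zero.2 hqi
    calc δ ≤ (q i : ℝ) * G.c l i := by nlinarith
      _ ≤ G.weightedQueue l q :=
        Finset.single_le_sum (f := fun i => toRealVec q i * G.c l i)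
          (fun i _ => mul_nonneg (Nat.cast_nonneg _) (G.c_nonneg l i)) (Finset.mem_univ i)

theorem weightedQueue_eq_zero (hq : ∀ i, 0 < G.c l i → q i = 0) : G.weightedQueue l q = 0 := by
  unfold weightedQueue dotProduct
  refine Finset.sum_eq_zero fun i _ => ?_
  rcases (G.c_nonneg l i).eq_or_lt with h | h
  · rw [← h, mul_zero]
  · simp [toRealVec, hq i h]

/-- A fixed fraction of the lost service contributes to `lossSlack`, whatever the queue lengths.
If the weighted queue length is positive this holds for every outcome. If it is zero, the random
tie-breaking selects with probability at least `θ` a schedule without weighted service, so that the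
arrivals of the slot are left in the queues while work is lost. -/
theorem exists_lossSlack_ge {ν : Fin n → ℝ} (hν : ν ∈ G.face l) (Amax : ℕ) (hθ : 0 < θ) :
    ∃ κ > 0, ∀ ε : ℝ, ε ≤ 1 / 2 → ∀ α, IsArrivalLaw ((1 - ε) • ν) Amax α →
      ∀ σ, G.IsMaxWeight θ σ → ∀ q, κ * G.slotMean Amax α σ q (G.lostService l q) ≤
        G.slotMean Amax α σ q (G.lossSlack l q) := by
  obtain ⟨δ, hδ, -, hgap⟩ := G.exists_weightedQueue_gap l
  obtain ⟨m₀, hm₀, hB₀⟩ := exists_maxService_pos hν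
  have hbM : 0 < G.bMax := hB₀.trans_le (G.maxService_le_bMax l m₀)
  have hψ : 0 < (G.ψ m₀).toReal := ENNReal.toReal_pos hm₀ (G.ψ.apply_ne_top m₀)
  have hb := G.b_pos l
  set r := (G.ψ m₀).toReal * θ * (G.b l * G.maxService m₀ l) with hr
  have hr0 : 0 < r := by positivity
  refine ⟨min δ (r / G.bMax), lt_min hδ (by positivity), fun ε hε α hα σ hσ q => ?_⟩
  have hU0 : 0 ≤ G.slotMean Amax α σ q (G.lostService l q) :=
    le_slotMean hσ.isPolicy hα.1 fun t ht => lostService_nonneg ht.service_mem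
  rcases hgap q with hq | hq
  · obtain ⟨s, hs, hs0⟩ := exists_mem_argmaxSet_eq_zero hm₀ hq
    have hcs : ∀ u : Fin n → ℕ, (∀ i, u i ≤ s i) → G.c l ⬝ᵥ toRealVec u = 0 := fun u hu =>
      Finset.sum_eq_zero fun i _ => by
        rcases (G.c_nonneg l i).eq_or_lt with h | h
        · rw [← h, zero_mul]
        · have : u i = 0 := Nat.le_zero.1 ((hu i).trans_eq (hs0 i h))
          simp [toRealVec, this]
    have hlost : ∀ a, G.lostService l q (m₀, s, a) = G.maxService m₀ l := fun a => by
      rw [lostService, hcs s fun _ => le_rfl, hcs (unusedService q a s) fun i => Nat.sub_le _ _]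
      ring
    have hnext : ∀ a, G.weightedQueue l (next q (m₀, s, a)) = G.c l ⬝ᵥ toRealVec a := fun a => by
      rw [weightedQueue_next, hlost, weightedQueue_eq_zero hq]; ring
    have h1 := mul_sum_le_slotMean (q := q) hσ.isPolicy hα.1
      (f := fun t => G.weightedQueue l (next q t) * G.lostService l q t)
      (fun t ht => mul_nonneg (G.weightedQueue_nonneg l _) (lostService_nonneg ht.service_mem))
      hs.1 (m := m₀)
    simp only [hlost, hnext, ← mul_assoc] at h1
    rw [← Finset.sum_mul, hα.sum_dotProduct, dotProduct_smul, hν.2, smul_eq_mul] at h1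
    have h2 : 2 * G.slotMean Amax α σ q
        (fun t => G.weightedQueue l (next q t) * G.lostService l q t) ≤
        G.slotMean Amax α σ q (G.lossSlack l q) := by
      rw [← slotMean_const_mul]
      exact slotMean_mono hσ.isPolicy hα.1 fun t ht => ht.lossSlack_ge
    have h3 : r ≤ 2 * ((G.ψ m₀).toReal * (σ q m₀ s).toReal *
        ((1 - ε) * G.b l * G.maxService m₀ l)) := by
      calc r = 2 * ((G.ψ m₀).toReal * θ * (1 / 2 * G.b l * G.maxService m₀ l)) := by
            rw [hr]; ring
        _ ≤ _ := by
            have := (hσ q m₀).2 s hs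
            gcongr
            linarith
    have h4 : G.slotMean Amax α σ q (G.lostService l q) ≤ G.bMax :=
      slotMean_le hσ.isPolicy hα.1 fun t _ => G.lostService_le_bMax l q t
    calc min δ (r / G.bMax) * G.slotMean Amax α σ q (G.lostService l q)
        ≤ r / G.bMax * G.bMax := by gcongr; exact min_le_right _ _
      _ = r := div_mul_cancel₀ _ hbM.ne'
      _ ≤ _ := by linarith
  · calc min δ (r / G.bMax) * G.slotMean Amax α σ q (G.lostService l q)
        ≤ δ * G.slotMean Amax α σ q (G.lostService l q) := by gcongr; exact min_le_left _ _
      _ ≤ _ := by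
        rw [← slotMean_const_mul]
        refine slotMean_mono hσ.isPolicy hα.1 fun t ht => ?_
        have hU := lostService_nonneg (l := l) (q := q) ht.service_mem
        rcases hgap (next q t) with h | h
        · have hQ := weightedQueue_eq_zero h
          have hA := G.dotProduct_toRealVec_nonneg l t.2.2
          have hB := G.maxService_le_bMax l t.1
          rw [lossSlack, hQ]
          rw [weightedQueue_next] at hQ
          have : δ ≤ G.bMax - G.lostService l q t := by linarith
          nlinarith [mul_le_mul_of_nonneg_left this hU]
        · refine le_trans ?_ ht.lossSlack_ge
          nlinarith [mul_le_mul_of_nonneg_right h hU]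

/-- MaxWeight with random tie-breaking satisfies the lower bound `ULB` without correction term. -/
theorem IsSteadyState.maxWeight_lower_bound {ν : Fin n → ℝ} (hν : ν ∈ G.face l) {ε κ : ℝ}
    (hε : 0 < ε) (hκε : ε * G.bMax ≤ κ)
    (hπ : G.IsSteadyState α σ π) (hσ : G.IsPolicy σ) (hα : IsArrivalLaw ((1 - ε) • ν) Amax α)
    (hκ : ∀ q, κ * G.slotMean Amax α σ q (G.lostService l q) ≤
      G.slotMean Amax α σ q (G.lossSlack l q))
    (hfin : G.FiniteMean l π) : G.ULB l α ε ≤ G.meanQueue l π := by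
  have h1 := hπ.mean_identity hσ hα hfin
  have h2 := hπ.integral_lostService (l := l) hσ hα
  have hI0 := integrable_slotMean_lostService (l := l) (π := π) hσ hα.1
  have hI1 := integrable_slotMean_next_mul_lostService hσ hα.1 hfin
  have hI2 := integrable_slotMean_lostService_sq (l := l) (π := π) hσ hα.1
  have hslack : ∀ q, G.slotMean Amax α σ q (G.lossSlack l q) =
      (G.bMax * G.slotMean Amax α σ q (G.lostService l q) -
        G.slotMean Amax α σ q (fun t => G.lostService l q t ^ 2)) +
      2 * G.slotMean Amax α σ q
        (fun t => G.weightedQueue l (next q t) * G.lostService l q t) := fun q => by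
    rw [← slotMean_const_mul, ← slotMean_const_mul, ← slotMean_sub, ← slotMean_add]
    congr 1 with t
    rw [lossSlack]; ring
  simp only [hslack] at hκ
  have hI3 : Integrable (fun q => G.bMax * G.slotMean Amax α σ q (G.lostService l q) -
      G.slotMean Amax α σ q (fun t => G.lostService l q t ^ 2)) π.toMeasure :=
    (hI0.const_mul _).sub hI2
  have h3 := integral_mono (hI0.const_mul κ) (hI3.add (hI1.const_mul 2)) hκ
  rw [integral_add' hI3 (hI1.const_mul 2), integral_sub (hI0.const_mul _) hI2,
    integral_const_mul, integral_const_mul, integral_const_mul, h2] at h3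
  rw [← neg_sub (G.meanB l)] at h1
  rw [dotProduct_arrivalMean hν] at h1 h3
  refine le_of_mul_le_mul_left ?_ (mul_pos two_pos (mul_pos hε (G.b_pos l)))
  rw [two_mul_ULB hε]
  have h4 := mul_le_mul_of_nonneg_left hκε (mul_pos hε (G.b_pos l)).le
  nlinarith [sq_nonneg (ε * G.b l)]

end GenSwitch

/-! ### Geometry of the facet and the component orthogonal to its normal vector -/

section Euclidean

variable {n : ℕ}

theorem norm_toLp_sq (v : Fin n → ℝ) : ‖WithLp.toLp 2 v‖ ^ 2 = v ⬝ᵥ v := by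
  rw [EuclideanSpace.real_norm_sq_eq]
  exact Finset.sum_congr rfl fun i _ => sq _

theorem abs_dotProduct_le_norm_mul_norm (v w : Fin n → ℝ) :
    |v ⬝ᵥ w| ≤ ‖WithLp.toLp 2 v‖ * ‖WithLp.toLp 2 w‖ := by
  refine abs_le_of_sq_le_sq ?_ (by positivity)
  rw [mul_pow, norm_toLp_sq, norm_toLp_sq, dotProduct, dotProduct, dotProduct]
  simpa only [sq] using Finset.sum_mul_sq_le_sq_mul_sq Finset.univ v w

theorem abs_apply_le_norm_toLp (v : Fin n → ℝ) (i : Fin n) : |v i| ≤ ‖WithLp.toLp 2 v‖ :=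
  PiLp.norm_apply_le (WithLp.toLp 2 v) i

theorem norm_toLp_le_of_abs_le {v : Fin n → ℝ} {k : ℝ} (h : ∀ i, |v i| ≤ k) (hk : 0 ≤ k) :
    ‖WithLp.toLp 2 v‖ ≤ n * k := by
  refine abs_le_of_sq_le_sq' ?_ (by positivity) |>.2
  rw [norm_toLp_sq]
  calc v ⬝ᵥ v ≤ ∑ _i : Fin n, k ^ 2 := Finset.sum_le_sum fun i _ => by
        rw [← abs_mul_abs_self, ← sq]
        exact pow_le_pow_left₀ (abs_nonneg _) (h i) 2
    _ = n * k ^ 2 := by simp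
    _ ≤ (n * k) ^ 2 := by
      have : (n : ℝ) ≤ (n : ℝ) ^ 2 := by exact_mod_cast Nat.le_self_pow two_ne_zero n
      rw [mul_pow]
      gcongr

/-- The component of `v` orthogonal to the unit vector `c`. -/
def perp (c v : Fin n → ℝ) : Fin n → ℝ := v - (v ⬝ᵥ c) • c

theorem perp_sub (c v w : Fin n → ℝ) : perp c v - perp c w = perp c (v - w) := by
  simp only [perp, sub_dotProduct, sub_smul]; abel

theorem dotProduct_perp_self (c v : Fin n → ℝ) :
    v ⬝ᵥ perp c v = v ⬝ᵥ v - (v ⬝ᵥ c) ^ 2 := by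
  rw [perp, dotProduct_sub, dotProduct_smul, smul_eq_mul, sq]

variable {c : Fin n → ℝ} (hc : c ⬝ᵥ c = 1) (v : Fin n → ℝ)
include hc

theorem dotProduct_perp : c ⬝ᵥ perp c v = 0 := by
  rw [perp, dotProduct_sub, dotProduct_smul, hc, dotProduct_comm c v, smul_eq_mul, mul_one,
    sub_self]

theorem norm_perp_sq : ‖WithLp.toLp 2 (perp c v)‖ ^ 2 = v ⬝ᵥ v - (v ⬝ᵥ c) ^ 2 := by
  rw [norm_toLp_sq]
  conv_lhs => rw [perp, sub_dotProduct, smul_dotProduct, ← perp, dotProduct_perp hc v]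
  rw [smul_zero, sub_zero, dotProduct_perp_self]

theorem norm_perp_le : ‖WithLp.toLp 2 (perp c v)‖ ≤ ‖WithLp.toLp 2 v‖ := by
  refine abs_le_of_sq_le_sq' ?_ (by positivity) |>.2
  rw [norm_perp_sq hc, norm_toLp_sq]
  linarith [sq_nonneg (v ⬝ᵥ c)]

end Euclidean

namespace GenSwitch

variable {n L : ℕ} {M : Type*} [Fintype M] {G : GenSwitch n L M} {l : Fin L} {Amax : ℕ}
  {α : PMF (Fin n → ℕ)} {σ : (Fin n → ℕ) → M → PMF (Fin n → ℕ)} {π : PMF (Fin n → ℕ)}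
  {lam : Fin n → ℝ} {q : Fin n → ℕ} {θ : ℝ}

/-- A facet spans the whole hyperplane orthogonal to its normal vector. -/
theorem IsFacet.mem_vectorSpan (hl : G.IsFacet l) {v : Fin n → ℝ} (hv : G.c l ⬝ᵥ v = 0) :
    v ∈ vectorSpan ℝ (G.face l) := by
  set f := dotProductBilin ℝ ℝ (G.c l) with hf
  have hle : vectorSpan ℝ (G.face l) ≤ LinearMap.ker f := by
    refine Submodule.span_le.2 ?_
    rintro _ ⟨x, hx, y, hy, rfl⟩
    change G.c l ⬝ᵥ (x - y) = 0
    rw [dotProduct_sub, hx.2, hy.2, sub_self]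
  have hlt : LinearMap.ker f < ⊤ := by
    refine lt_top_iff_ne_top.2 fun h => ?_
    have : G.c l ∈ LinearMap.ker f := h ▸ Submodule.mem_top
    have h0 : G.c l ⬝ᵥ G.c l = 0 := this
    rw [G.c_norm] at h0
    exact one_ne_zero h0
  have hfin := Submodule.finrank_lt hlt.ne
  rw [Module.finrank_fin_fun] at hfin
  have h2 := hl.2
  rw [Submodule.eq_of_le_of_finrank_le hle (by omega)]
  exact hv

/-- Complete resource pooling: a relatively interior point of the facet can be moved a little in
every direction within the hyperplane of the facet. -/
theorem IsFacet.exists_add_mem (hl : G.IsFacet l) {ν : Fin n → ℝ}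
    (hν : ν ∈ intrinsicInterior ℝ (G.face l)) :
    ∃ r > 0, ∀ v, G.c l ⬝ᵥ v = 0 → (∀ i, |v i| ≤ r) → ν + v ∈ capacityRegion G.ψ G.S := by
  obtain ⟨y, hy, rfl⟩ := mem_intrinsicInterior.1 hν
  obtain ⟨ρ, hρ, hball⟩ := Metric.mem_nhds_iff.1 (mem_interior_iff_mem_nhds.1 hy)
  refine ⟨ρ / 2, by positivity, fun v hv hvr => ?_⟩
  have hmem : (y : Fin n → ℝ) + v ∈ affineSpan ℝ (G.face l) := by
    rw [add_comm]
    refine AffineSubspace.vadd_mem_of_mem_direction ?_ y.2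
    rw [direction_affineSpan]
    exact hl.mem_vectorSpan hv
  have : (⟨_, hmem⟩ : affineSpan ℝ (G.face l)) ∈ Metric.ball y ρ := by
    rw [Metric.mem_ball, Subtype.dist_eq, dist_eq_norm, add_sub_cancel_left]
    refine lt_of_le_of_lt ((pi_norm_le_iff_of_nonneg (by positivity)).2 hvr) ?_
    linarith
  exact (hball this).1

/-- A bound on the change of each queue length in one slot. -/
def maxJump (G : GenSwitch n L M) (Amax : ℕ) : ℕ := Amax + ∑ s ∈ G.services, ∑ i, s i

theorem add_service_le {m : M} {s : Fin n → ℕ} (hs : s ∈ G.S m) (Amax : ℕ) (i : Fin n) : Amax + s i ≤ G.maxJump Amax := by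
  have h1 : s i ≤ ∑ i, s i := Finset.single_le_sum (fun _ _ => Nat.zero_le _) (Finset.mem_univ i)
  have h2 : ∑ i, s i ≤ ∑ s ∈ G.services, ∑ i, s i :=
    Finset.single_le_sum (f := fun s : Fin n → ℕ => ∑ i, s i) (fun _ _ => Nat.zero_le _)
      (G.mem_services hs)
  unfold maxJump; omega

theorem Feasible.norm_next_sub_le {t : M × (Fin n → ℕ) × (Fin n → ℕ)}
    (ht : G.Feasible Amax σ q t) :
    ‖WithLp.toLp 2 (toRealVec (next q t) - toRealVec q)‖ ≤ n * G.maxJump Amax := by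
  refine norm_toLp_le_of_abs_le (fun i => ?_) (Nat.cast_nonneg _)
  have h1 := add_service_le ht.service_mem Amax i
  have h2 := ht.arrival_le i
  have h3 : next q t i ≤ q i + G.maxJump Amax ∧ q i ≤ next q t i + G.maxJump Amax := by
    simp only [next, nextQueue]; omega
  have h4 : (next q t i : ℝ) ≤ q i + G.maxJump Amax := by exact_mod_cast h3.1
  have h5 : (q i : ℝ) ≤ next q t i + G.maxJump Amax := by exact_mod_cast h3.2
  simp only [Pi.sub_apply, toRealVec]
  rw [abs_le]; constructor <;> linarith

/-- The Euclidean norm of the component of the queue lengths orthogonal to `c l`. -/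
noncomputable def perpNorm (G : GenSwitch n L M) (l : Fin L) (q : Fin n → ℕ) : ℝ :=
  ‖WithLp.toLp 2 (perp (G.c l) (toRealVec q))‖

theorem perpNorm_sq (G : GenSwitch n L M) (l : Fin L) (q : Fin n → ℕ) :
    G.perpNorm l q ^ 2 = toRealVec q ⬝ᵥ toRealVec q - G.weightedQueue l q ^ 2 :=
  norm_perp_sq (G.c_norm l) _

theorem Feasible.abs_perpNorm_sub_le {t : M × (Fin n → ℕ) × (Fin n → ℕ)}
    (ht : G.Feasible Amax σ q t) :
    |G.perpNorm l (next q t) - G.perpNorm l q| ≤ n * G.maxJump Amax := by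
  refine (abs_norm_sub_norm_le _ _).trans ?_
  rw [← WithLp.toLp_sub, perp_sub]
  exact (norm_perp_le (G.c_norm l) _).trans ht.norm_next_sub_le

/-! ### Drift of MaxWeight: stability and state-space collapse -/

theorem IsMaxWeight.dotProduct_le_slotMean (hσ : G.IsMaxWeight θ σ)
    (hα : ∀ a ∈ α.support, ∀ i, a i ≤ Amax) {x : Fin n → ℝ} (hx : x ∈ capacityRegion G.ψ G.S)
    (q : Fin n → ℕ) :
    toRealVec q ⬝ᵥ x ≤ G.slotMean Amax α σ q (fun t => toRealVec q ⬝ᵥ toRealVec t.2.1) := by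
  obtain ⟨y, hy, rfl⟩ := hx
  rw [dotProduct_sum]
  simp only [dotProduct_smul, smul_eq_mul]
  rw [← slotMean_state (q := q) hσ.isPolicy hα fun m => toRealVec q ⬝ᵥ y m]
  exact slotMean_mono hσ.isPolicy hα fun t ht =>
    dotProduct_le_of_mem_argmaxSet ((hσ q t.1).1 _ ht.selected) (hy t.1)

theorem Feasible.dotProduct_self_next_le {t : M × (Fin n → ℕ) × (Fin n → ℕ)}
    (ht : G.Feasible Amax σ q t) :
    toRealVec (next q t) ⬝ᵥ toRealVec (next q t) ≤ toRealVec q ⬝ᵥ toRealVec q +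
      2 * (toRealVec q ⬝ᵥ toRealVec t.2.2 - toRealVec q ⬝ᵥ toRealVec t.2.1) +
      (n * G.maxJump Amax) ^ 2 := by
  have h1 : ‖WithLp.toLp 2 (toRealVec t.2.2 - toRealVec t.2.1)‖ ≤ n * G.maxJump Amax := by
    refine norm_toLp_le_of_abs_le (fun i => ?_) (Nat.cast_nonneg _)
    have h1 := add_service_le ht.service_mem Amax i
    have h2 := ht.arrival_le i
    have h3 : (t.2.2 i : ℝ) ≤ G.maxJump Amax := by exact_mod_cast (by omega)
    have h4 : (t.2.1 i : ℝ) ≤ G.maxJump Amax := by exact_mod_cast (by omega)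
    have h5 : (0 : ℝ) ≤ t.2.2 i := Nat.cast_nonneg _
    have h6 : (0 : ℝ) ≤ t.2.1 i := Nat.cast_nonneg _
    simp only [Pi.sub_apply, toRealVec]
    rw [abs_le]; constructor <;> linarith
  have h2 := pow_le_pow_left₀ (norm_nonneg _) h1 2
  rw [norm_toLp_sq] at h2
  refine le_trans ?_ (add_le_add_right h2 _)
  simp only [dotProduct, ← Finset.sum_sub_distrib, Finset.mul_sum, ← Finset.sum_add_distrib]
  refine Finset.sum_le_sum fun i _ => ?_
  have h3 : ((next q t i : ℕ) : ℝ) = max ((q i : ℝ) + t.2.2 i - t.2.1 i) 0 := by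
    simp only [next, nextQueue]
    rcases le_total (t.2.1 i) (q i + t.2.2 i) with h | h
    · have h' : (t.2.1 i : ℝ) ≤ q i + t.2.2 i := by exact_mod_cast h
      rw [max_eq_left (by linarith), Nat.cast_sub h, Nat.cast_add]
    · have h' : (q i : ℝ) + t.2.2 i ≤ t.2.1 i := by exact_mod_cast h
      rw [max_eq_right (by linarith), Nat.sub_eq_zero_of_le h, Nat.cast_zero]
  have h4 : ((next q t i : ℕ) : ℝ) * (next q t i : ℕ) ≤
      ((q i : ℝ) + t.2.2 i - t.2.1 i) * ((q i : ℝ) + t.2.2 i - t.2.1 i) := by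
    rw [h3]
    rcases le_total ((q i : ℝ) + t.2.2 i - t.2.1 i) 0 with h | h
    · rw [max_eq_right h]; nlinarith
    · rw [max_eq_left h]
  simp only [toRealVec, Pi.sub_apply]
  nlinarith

/-- Arrival rates below the capacity region leave room for extra load in the direction `c l`. -/
theorem exists_add_smul_mem {ν : Fin n → ℝ} (hν : ν ∈ capacityRegion G.ψ G.S) (l : Fin L) {ε : ℝ}
    (hε : 0 < ε) (hε1 : ε < 1) :
    ∃ η : ℝ, 0 < η ∧ (1 - ε) • ν + η • G.c l ∈ capacityRegion G.ψ G.S := by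
  have hcc : ∀ l', 0 ≤ G.c l' ⬝ᵥ G.c l := fun l' =>
    Finset.sum_nonneg fun i _ => mul_nonneg (G.c_nonneg l' i) (G.c_nonneg l i)
  obtain ⟨η, hη, h⟩ := Finite.exists_pos_forall_le_zero_or_le
    fun l' => ε * G.b l' / (1 + G.c l' ⬝ᵥ G.c l)
  refine ⟨η, hη, ?_⟩
  rw [G.capacity_eq] at hν ⊢
  refine ⟨fun i => ?_, fun l' => ?_⟩
  · have := hν.1 i
    have := G.c_nonneg l i
    have : 0 ≤ 1 - ε := by linarith
    simp only [Pi.add_apply, Pi.smul_apply, smul_eq_mul]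
    positivity
  · have hb := G.b_pos l'
    have hc' := hcc l'
    have hpos : 0 < ε * G.b l' / (1 + G.c l' ⬝ᵥ G.c l) := by positivity
    have h1 := (h l').resolve_left (not_le.2 hpos)
    rw [le_div_iff₀ (by positivity)] at h1
    rw [dotProduct_add, dotProduct_smul, dotProduct_smul, smul_eq_mul, smul_eq_mul]
    have h2 := mul_le_mul_of_nonneg_left (hν.2 l') (by linarith : (0 : ℝ) ≤ 1 - ε)
    nlinarith

/-- Every steady state of MaxWeight has a finite mean. -/
theorem IsSteadyState.finiteMean_of_isMaxWeight {ν : Fin n → ℝ}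
    (hν : ν ∈ capacityRegion G.ψ G.S) (l : Fin L) {ε : ℝ} (hε : 0 < ε) (hε1 : ε < 1)
    (hπ : G.IsSteadyState α σ π) (hσ : G.IsMaxWeight θ σ)
    (hα : IsArrivalLaw ((1 - ε) • ν) Amax α) : G.FiniteMean l π := by
  obtain ⟨η, hη, hmem⟩ := exists_add_smul_mem hν l hε hε1
  have h := (hπ.isStationaryStep hσ.isPolicy hα.1).foster
    (f := fun q => toRealVec q ⬝ᵥ toRealVec q) (g := fun q => 2 * η * G.weightedQueue l q)
    (K := (n * G.maxJump Amax) ^ 2)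
    (fun q => Finset.sum_nonneg fun i _ => mul_self_nonneg _)
    (fun q => mul_nonneg (by positivity) (G.weightedQueue_nonneg l q)) (by positivity) fun q => ?_
  · have hi : Integrable (G.weightedQueue l) π.toMeasure := by
      have := h.1.const_mul (2 * η)⁻¹
      simpa only [← mul_assoc, inv_mul_cancel₀ (mul_pos two_pos hη).ne', one_mul] using this
    exact hi
  · have h1 := hσ.dotProduct_le_slotMean hα.1 hmem q
    rw [dotProduct_add, dotProduct_smul _ _ (G.c l), smul_eq_mul] at h1
    change _ + η * G.weightedQueue l q ≤ _ at h1
    have h2 := slotMean_mono (q := q) hσ.isPolicy hα.1 fun t ht => ht.dotProduct_self_next_le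
    rw [slotMean_add, slotMean_add, slotMean_const_mul, slotMean_sub,
      slotMean_const hσ.isPolicy hα.1, slotMean_const hσ.isPolicy hα.1,
      slotMean_arrival_dotProduct hσ.isPolicy hα] at h2
    refine h2.trans ?_
    linarith

/-- The drift of the squared orthogonal component. The margin `r` of complete resource pooling
yields a negative drift of order `r * perpNorm`, which survives for small `ε`. -/
theorem slotMean_perpNorm_sq_sub_le {ν : Fin n → ℝ} (hν : ν ∈ G.face l) {r : ℝ} (hr : 0 < r)
    (hpool : ∀ v, G.c l ⬝ᵥ v = 0 → (∀ i, |v i| ≤ r) → ν + v ∈ capacityRegion G.ψ G.S) {ε : ℝ}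
    (hε : 0 < ε) (hεr : ε * ‖WithLp.toLp 2 ν‖ ≤ r / 2) (hσ : G.IsMaxWeight θ σ)
    (hα : IsArrivalLaw ((1 - ε) • ν) Amax α) (q : Fin n → ℕ) :
    G.slotMean Amax α σ q (fun t => G.perpNorm l (next q t) ^ 2 - G.perpNorm l q ^ 2) ≤
      -r * G.perpNorm l q + (n * G.maxJump Amax) ^ 2 := by
  set x := G.perpNorm l q with hx
  have hx0 : 0 ≤ x := norm_nonneg _
  set p := perp (G.c l) (toRealVec q) with hp
  have hpx : toRealVec q ⬝ᵥ p = x ^ 2 := by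
    rw [hp, dotProduct_perp_self, hx, perpNorm_sq]; rfl
  have hserv : toRealVec q ⬝ᵥ ν + r * x ≤
      G.slotMean Amax α σ q (fun t => toRealVec q ⬝ᵥ toRealVec t.2.1) := by
    have hmem : ν + (r / x) • p ∈ capacityRegion G.ψ G.S := by
      refine hpool _ ?_ fun i => ?_
      · rw [dotProduct_smul, hp, dotProduct_perp (G.c_norm l), smul_zero]
      · rw [Pi.smul_apply, smul_eq_mul, abs_mul, abs_of_nonneg (by positivity)]
        have h1 : |p i| ≤ x := abs_apply_le_norm_toLp p i
        calc r / x * |p i| ≤ r / x * x := by gcongr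
          _ ≤ r := by
            rcases hx0.eq_or_lt with h | h
            · rw [← h, mul_zero]; exact hr.le
            · exact (div_mul_cancel₀ r h.ne').le
    have h1 := hσ.dotProduct_le_slotMean hα.1 hmem q
    rw [dotProduct_add, dotProduct_smul, smul_eq_mul, hpx] at h1
    have h2 : r / x * x ^ 2 = r * x := by
      rcases hx0.eq_or_lt with h | h
      · rw [← h]; simp
      · field_simp
    linarith
  have hqν : toRealVec q ⬝ᵥ ν = G.weightedQueue l q * G.b l + p ⬝ᵥ ν := by
    rw [hp, perp, sub_dotProduct, smul_dotProduct, hν.2, smul_eq_mul]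
    change _ = _ + (_ - G.weightedQueue l q * _)
    ring
  have hpν : |p ⬝ᵥ ν| ≤ x * ‖WithLp.toLp 2 ν‖ := abs_dotProduct_le_norm_mul_norm p ν
  have hpt : ∀ t, G.Feasible Amax σ q t → G.perpNorm l (next q t) ^ 2 - x ^ 2 ≤
      2 * (toRealVec q ⬝ᵥ toRealVec t.2.2 - toRealVec q ⬝ᵥ toRealVec t.2.1) -
      2 * G.weightedQueue l q * (G.c l ⬝ᵥ toRealVec t.2.2 - G.maxService t.1 l) +
      (n * G.maxJump Amax) ^ 2 := fun t ht => by
    have h1 := ht.dotProduct_self_next_le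
    have h2 := lostService_nonneg (l := l) (q := q) ht.service_mem
    have h3 := G.weightedQueue_nonneg l q
    rw [hx, perpNorm_sq, perpNorm_sq]
    have h4 : G.weightedQueue l q ^ 2 +
        2 * G.weightedQueue l q * (G.c l ⬝ᵥ toRealVec t.2.2 - G.maxService t.1 l) ≤
        G.weightedQueue l (next q t) ^ 2 := by
      rw [weightedQueue_next]
      nlinarith [mul_nonneg h3 h2, sq_nonneg ((G.c l ⬝ᵥ toRealVec t.2.2 - G.maxService t.1 l) +
        G.lostService l q t)]
    linarith
  refine (slotMean_mono (q := q) hσ.isPolicy hα.1 hpt).trans ?_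
  rw [slotMean_add, slotMean_sub, slotMean_const_mul, slotMean_const_mul,
    slotMean_netInput hσ.isPolicy hα, slotMean_sub,
    slotMean_const hσ.isPolicy hα.1, slotMean_arrival_dotProduct hσ.isPolicy hα,
    ← neg_sub (G.meanB l), dotProduct_arrivalMean hν, dotProduct_smul, smul_eq_mul]
  have h1 := (abs_le.1 hpν).1
  have h2 : -(ε * (p ⬝ᵥ ν)) ≤ r / 2 * x := by nlinarith
  have h3 : (1 - ε) * (toRealVec q ⬝ᵥ ν) + G.weightedQueue l q * (ε * G.b l) =
      toRealVec q ⬝ᵥ ν - ε * (p ⬝ᵥ ν) := by rw [hqν]; ring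
  nlinarith

/-- State-space collapse: the orthogonal component of the queue lengths has an exponential moment
in steady state that is bounded uniformly in heavy traffic. -/
theorem IsFacet.exists_stateSpaceCollapse (hl : G.IsFacet l) {ν : Fin n → ℝ}
    (hν : ν ∈ intrinsicInterior ℝ (G.face l)) (Amax : ℕ) (θ : ℝ) :
    ∃ ε₁ > 0, ∃ κ > 0, ∃ C, 0 ≤ C ∧ ∀ ε : ℝ, 0 < ε → ε < ε₁ → ∀ α,
      IsArrivalLaw ((1 - ε) • ν) Amax α → ∀ σ π, G.IsMaxWeight θ σ → G.IsSteadyState α σ π →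
      Integrable (fun q => Real.exp (κ * G.perpNorm l q)) π.toMeasure ∧
        ∫ q, Real.exp (κ * G.perpNorm l q) ∂π.toMeasure ≤ C := by
  obtain ⟨r, hr, hpool⟩ := hl.exists_add_mem hν
  obtain ⟨κ, hκ, C, hC, h⟩ := IsStationaryStep.exists_integral_exp_le
    (ι := M × (Fin n → ℕ) × (Fin n → ℕ)) (D := n * G.maxJump Amax + 1) (r := r)
    (K := (n * G.maxJump Amax) ^ 2 + 1) (by positivity) hr (by positivity) (G.perpNorm l)
  refine ⟨r / 2 / (‖WithLp.toLp 2 ν‖ + 1), by positivity, κ, hκ, C, hC,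
    fun ε hε hε₁ α hα σ π hσ hπ => ?_⟩
  refine h π.toMeasure _ _ _ (hπ.isStationaryStep hσ.isPolicy hα.1) (fun q t _ hw => ?_)
    fun q => ?_
  · linarith [(feasible_of_weight_ne_zero hσ.isPolicy hα.1 hw).abs_perpNorm_sub_le (l := l)]
  · rw [lt_div_iff₀ (by positivity)] at hε₁
    have := slotMean_perpNorm_sq_sub_le (intrinsicInterior_subset hν) hr hpool hε
      (by linarith) hσ hα q
    exact this.trans (by linarith)

end GenSwitch

/-! ### The logarithmic upper bound -/

namespace GenSwitch

variable {n L : ℕ} {M : Type*} [Fintype M] {G : GenSwitch n L M} {l : Fin L} {Amax : ℕ}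
  {α : PMF (Fin n → ℕ)} {σ : (Fin n → ℕ) → M → PMF (Fin n → ℕ)} {π : PMF (Fin n → ℕ)}
  {lam : Fin n → ℝ} {q : Fin n → ℕ} {θ : ℝ}

theorem exists_maxService_gap (G : GenSwitch n L M) (l : Fin L) :
    ∃ γ > 0, ∀ m, ∀ s ∈ G.S m, G.maxService m l - G.c l ⬝ᵥ toRealVec s ≤ 0 ∨
      γ ≤ G.maxService m l - G.c l ⬝ᵥ toRealVec s := by
  obtain ⟨γ, hγ, h⟩ := Finite.exists_pos_forall_le_zero_or_le
    fun p : Σ m, {s // s ∈ G.S m} => G.maxService p.1 l - G.c l ⬝ᵥ toRealVec p.2.1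
  exact ⟨γ, hγ, fun m s hs => h ⟨m, s, hs⟩⟩

/-- If a weighted queue has unused service, it is empty at the end of the slot, so the weighted
queue length is controlled by the orthogonal component. -/
theorem mul_weightedQueue_next_le {δ : ℝ} (hδ : ∀ i, G.c l i ≤ 0 ∨ δ ≤ G.c l i)
    {t : M × (Fin n → ℕ) × (Fin n → ℕ)}
    (hu : 0 < G.c l ⬝ᵥ toRealVec (unusedService q t.2.2 t.2.1)) :
    δ * G.weightedQueue l (next q t) ≤ G.perpNorm l (next q t) := by
  obtain ⟨i, -, hi⟩ := Finset.exists_lt_of_sum_lt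
    (f := fun _ : Fin n => (0 : ℝ)) (by simpa [dotProduct] using hu)
  have hui : 0 < unusedService q t.2.2 t.2.1 i := by
    rcases Nat.eq_zero_or_pos (unusedService q t.2.2 t.2.1 i) with h | h
    · simp [toRealVec, h] at hi
    · exact h
  have hci : 0 < G.c l i :=
    pos_of_mul_pos_left hi (Nat.cast_nonneg (unusedService q t.2.2 t.2.1 i))
  have hqi : next q t i = 0 :=
    (Nat.mul_eq_zero.1 (nextQueue_spec q t.2.2 t.2.1 i).2).resolve_right hui.ne'
  have hp : perp (G.c l) (toRealVec (next q t)) i = -(G.weightedQueue l (next q t) * G.c l i) := by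
    simp only [perp, Pi.sub_apply, Pi.smul_apply, smul_eq_mul, toRealVec, hqi, Nat.cast_zero,
      zero_sub]
    rfl
  have h := abs_apply_le_norm_toLp (perp (G.c l) (toRealVec (next q t))) i
  have hQ := G.weightedQueue_nonneg l (next q t)
  rw [hp, abs_neg, abs_of_nonneg (mul_nonneg hQ hci.le)] at h
  refine le_trans ?_ h
  rw [mul_comm]
  exact mul_le_mul_of_nonneg_left ((hδ i).resolve_left (not_le.2 hci)) hQ

/-- If MaxWeight selects a schedule with less `c l`-weighted service than possible, this is due to
the orthogonal component of the queue lengths. -/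
theorem weightedQueue_mul_gap_le (hσ : G.IsMaxWeight θ σ) {t : M × (Fin n → ℕ) × (Fin n → ℕ)}
    (ht : G.Feasible Amax σ q t) :
    G.weightedQueue l q * (G.maxService t.1 l - G.c l ⬝ᵥ toRealVec t.2.1) ≤
      G.perpNorm l q * (n * G.maxJump Amax) := by
  obtain ⟨s, hs, hsm⟩ := G.exists_eq_maxService l t.1
  have hmax := (mem_argmaxSet_iff.1 ((hσ q t.1).1 _ ht.selected)).2 s hs
  set p := perp (G.c l) (toRealVec q) with hp
  have hpv : ∀ v, p ⬝ᵥ v = toRealVec q ⬝ᵥ v - G.weightedQueue l q * (G.c l ⬝ᵥ v) := fun v => by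
    rw [hp, perp, sub_dotProduct, smul_dotProduct, smul_eq_mul]; rfl
  have h1 : ‖WithLp.toLp 2 (toRealVec t.2.1 - toRealVec s)‖ ≤ n * G.maxJump Amax := by
    refine norm_toLp_le_of_abs_le (fun i => ?_) (Nat.cast_nonneg _)
    have h1 := add_service_le ht.service_mem Amax i
    have h2 := add_service_le hs Amax i
    have h3 : (t.2.1 i : ℝ) ≤ G.maxJump Amax := by exact_mod_cast (by omega)
    have h4 : (s i : ℝ) ≤ G.maxJump Amax := by exact_mod_cast (by omega)
    have h5 : (0 : ℝ) ≤ t.2.1 i := Nat.cast_nonneg _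
    have h6 : (0 : ℝ) ≤ s i := Nat.cast_nonneg _
    simp only [Pi.sub_apply, toRealVec]
    rw [abs_le]; constructor <;> linarith
  have h2 := (abs_le.1 (abs_dotProduct_le_norm_mul_norm p (toRealVec t.2.1 - toRealVec s))).2
  have h3 : ‖WithLp.toLp 2 p‖ * ‖WithLp.toLp 2 (toRealVec t.2.1 - toRealVec s)‖ ≤
      G.perpNorm l q * (n * G.maxJump Amax) := mul_le_mul_of_nonneg_left h1 (norm_nonneg _)
  rw [dotProduct_sub, hpv, hpv, hsm] at h2
  linarith

/-- Whenever MaxWeight loses work, the weighted queue length at the end of the slot is at most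
affine in the orthogonal component. -/
theorem exists_next_mul_lostService_le (G : GenSwitch n L M) (l : Fin L) (Amax : ℕ) (θ : ℝ) :
    ∃ C₁ C₂ : ℝ, 0 ≤ C₁ ∧ 0 ≤ C₂ ∧ ∀ σ, G.IsMaxWeight θ σ → ∀ q t, G.Feasible Amax σ q t →
      G.weightedQueue l (next q t) * G.lostService l q t ≤
        (C₁ + C₂ * G.perpNorm l q) * G.lostService l q t := by
  obtain ⟨δ, hδ, hcδ, -⟩ := G.exists_weightedQueue_gap l
  obtain ⟨γ, hγ, hgap⟩ := G.exists_maxService_gap l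
  set D : ℝ := n * G.maxJump Amax with hD
  have hD0 : 0 ≤ D := by positivity
  have hJ : 0 ≤ |G.weightedJump l Amax| := abs_nonneg _
  refine ⟨D / δ + |G.weightedJump l Amax|, 1 / δ + D / γ, by positivity, by positivity,
    fun σ hσ q t ht => ?_⟩
  have hx : 0 ≤ G.perpNorm l q := norm_nonneg _
  rcases (lostService_nonneg (l := l) (q := q) ht.service_mem).eq_or_lt with hU | hU
  · rw [← hU, mul_zero, mul_zero]
  refine mul_le_mul_of_nonneg_right ?_ hU.le
  have hxγ : 0 ≤ D / γ * G.perpNorm l q := by positivity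
  have hxδ : 0 ≤ 1 / δ * G.perpNorm l q := by positivity
  have hDδ : 0 ≤ D / δ := by positivity
  rcases hgap t.1 t.2.1 ht.service_mem with h | h
  · have hu : 0 < G.c l ⬝ᵥ toRealVec (unusedService q t.2.2 t.2.1) := by
      unfold lostService at hU; linarith
    have h1 := mul_weightedQueue_next_le hcδ hu
    have h2 := (abs_le.1 (ht.abs_perpNorm_sub_le (l := l))).2
    have h3 : G.weightedQueue l (next q t) ≤ (G.perpNorm l q + D) / δ := by
      rw [le_div_iff₀ hδ]; linarith
    have h4 : (G.perpNorm l q + D) / δ = D / δ + 1 / δ * G.perpNorm l q := by ring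
    linarith
  · have h1 := weightedQueue_mul_gap_le (l := l) hσ ht
    have h2 := (abs_le.1 (ht.abs_weightedQueue_sub_le (l := l))).2
    have h3 : G.weightedQueue l q ≤ G.perpNorm l q * D / γ := by
      rw [le_div_iff₀ hγ]
      exact (mul_le_mul_of_nonneg_left h (G.weightedQueue_nonneg l q)).trans h1
    have h4 : G.perpNorm l q * D / γ = D / γ * G.perpNorm l q := by ring
    linarith [le_abs_self (G.weightedJump l Amax)]

/-- The part of the orthogonal component above the level `log (1 / ε) / κ` is paid for by `ε` times
its exponential moment. -/
theorem le_log_add_exp {ε κ x : ℝ} (hε : 0 < ε) (hκ : 0 < κ) :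
    x ≤ Real.log (1 / ε) / κ + ε / κ * Real.exp (κ * x) := by
  have h := Real.add_one_le_exp (κ * x - Real.log (1 / ε))
  rw [Real.exp_sub, Real.exp_log (by positivity), div_div_eq_mul_div, div_one] at h
  have h2 : Real.log (1 / ε) / κ + ε / κ * Real.exp (κ * x) =
      (Real.log (1 / ε) + Real.exp (κ * x) * ε) / κ := by ring
  rw [h2, le_div_iff₀ hκ]
  linarith

/-- The upper bound on the mean weighted queue length. The spare term `bMax / 2` on the left is kept
for the comparison with the universal lower bound. -/
theorem IsSteadyState.maxWeight_upper_bound {ν : Fin n → ℝ} (hν : ν ∈ G.face l)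
    {ε κ C C₁ C₂ : ℝ} (hε : 0 < ε) (hε1 : ε ≤ 1 / 2) (hκ : 0 < κ) (hC : 0 ≤ C) (hC₁ : 0 ≤ C₁)
    (hC₂ : 0 ≤ C₂) (hπ : G.IsSteadyState α σ π) (hσ : G.IsPolicy σ)
    (hα : IsArrivalLaw ((1 - ε) • ν) Amax α)
    (hU : ∀ q t, G.Feasible Amax σ q t → G.weightedQueue l (next q t) * G.lostService l q t ≤
      (C₁ + C₂ * G.perpNorm l q) * G.lostService l q t)
    (hexp : Integrable (fun q => Real.exp (κ * G.perpNorm l q)) π.toMeasure)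
    (hexpC : ∫ q, Real.exp (κ * G.perpNorm l q) ∂π.toMeasure ≤ C) (hfin : G.FiniteMean l π) :
    G.meanQueue l π + G.bMax / 2 ≤ G.ULB l α ε +
      (2 * (G.b l + G.bMax + C₁ + C₂ / κ * G.bMax * C / G.b l) + C₂ / κ) *
        Real.log (1 / ε) := by
  have hb := G.b_pos l
  obtain ⟨m, -, -⟩ := exists_maxService_pos hν
  have hbM : 0 ≤ G.bMax := bMax_nonneg_of_face l m
  set Λ := Real.log (1 / ε) with hΛ
  have hΛ1 : 1 / 2 ≤ Λ := by
    have h1 : Real.log 2 ≤ Λ := Real.log_le_log two_pos (by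
      rw [le_div_iff₀ hε]; linarith)
    linarith [Real.log_two_gt_d9]
  set I₁ := ∫ q, G.slotMean Amax α σ q
    (fun t => G.weightedQueue l (next q t) * G.lostService l q t) ∂π.toMeasure with hI₁
  have h1 := hπ.mean_identity hσ hα hfin
  have h2 := hπ.integral_lostService (l := l) hσ hα
  have hI0 := integrable_slotMean_lostService (l := l) (π := π) hσ hα.1
  have hI2 : 0 ≤ ∫ q, G.slotMean Amax α σ q (fun t => G.lostService l q t ^ 2) ∂π.toMeasure :=
    integral_nonneg fun q => le_slotMean hσ hα.1 fun t _ => sq_nonneg _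
  have hpt : ∀ q, G.slotMean Amax α σ q
      (fun t => G.weightedQueue l (next q t) * G.lostService l q t) ≤
      (C₁ + C₂ * (Λ / κ)) * G.slotMean Amax α σ q (G.lostService l q) +
        C₂ * (ε / κ) * G.bMax * Real.exp (κ * G.perpNorm l q) := fun q => by
    have hS0 : 0 ≤ G.slotMean Amax α σ q (G.lostService l q) :=
      le_slotMean hσ hα.1 fun t ht => lostService_nonneg ht.service_mem
    have hS1 : G.slotMean Amax α σ q (G.lostService l q) ≤ G.bMax :=
      slotMean_le hσ hα.1 fun t _ => G.lostService_le_bMax l q t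
    have hx := le_log_add_exp (x := G.perpNorm l q) hε hκ
    calc _ ≤ (C₁ + C₂ * G.perpNorm l q) * G.slotMean Amax α σ q (G.lostService l q) := by
          rw [← slotMean_const_mul]
          exact slotMean_mono hσ hα.1 (hU q)
      _ ≤ (C₁ + C₂ * (Λ / κ + ε / κ * Real.exp (κ * G.perpNorm l q))) *
          G.slotMean Amax α σ q (G.lostService l q) := by gcongr
      _ = (C₁ + C₂ * (Λ / κ)) * G.slotMean Amax α σ q (G.lostService l q) +
          C₂ * (ε / κ) * Real.exp (κ * G.perpNorm l q) *
            G.slotMean Amax α σ q (G.lostService l q) := by ring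
      _ ≤ (C₁ + C₂ * (Λ / κ)) * G.slotMean Amax α σ q (G.lostService l q) +
          C₂ * (ε / κ) * Real.exp (κ * G.perpNorm l q) * G.bMax := by gcongr
      _ = _ := by ring
  have h3 : I₁ ≤ (C₁ + C₂ * (Λ / κ)) * (ε * G.b l) + C₂ * (ε / κ) * G.bMax * C := by
    have h4 := integral_mono (integrable_slotMean_next_mul_lostService hσ hα.1 hfin)
      ((hI0.const_mul _).add (hexp.const_mul _)) hpt
    rw [integral_add' (hI0.const_mul _) (hexp.const_mul _), integral_const_mul,
      integral_const_mul, h2, dotProduct_arrivalMean hν] at h4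
    refine h4.trans (add_le_add_right (mul_le_mul_of_nonneg_left hexpC (by positivity)) _)
  rw [← neg_sub (G.meanB l), dotProduct_arrivalMean hν] at h1
  refine le_of_mul_le_mul_left ?_ (mul_pos two_pos (mul_pos hε hb))
  rw [mul_add, mul_add _ (G.ULB l α ε), h1, two_mul_ULB hε]
  -- Constants are absorbed into the logarithm by `1 ≤ 2 * log (1 / ε)`.
  set E := G.b l + G.bMax + C₁ + C₂ / κ * G.bMax * C / G.b l with hE
  have hE0 : 0 ≤ E := by positivity
  have h5 : E ≤ 2 * E * Λ := by nlinarith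
  have h6 : 2 * (ε * G.b l) * (E + C₂ / κ * Λ) ≤
      2 * (ε * G.b l) * ((2 * E + C₂ / κ) * Λ) :=
    mul_le_mul_of_nonneg_left (by linarith) (by positivity)
  have h7 : 2 * (ε * G.b l) * (E + C₂ / κ * Λ) = 2 * (ε * G.b l) * (G.b l + G.bMax) +
      2 * ((C₁ + C₂ * (Λ / κ)) * (ε * G.b l) + C₂ * (ε / κ) * G.bMax * C) := by
    rw [hE]; field_simp; ring
  have h8 : (-(ε * G.b l)) ^ 2 ≤ ε * G.b l * G.b l := by nlinarith [mul_pos hε hb]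
  have h9 : 0 ≤ ε * G.b l * (ε * G.bMax) := by positivity
  have h10 : 0 < ε * G.b l * G.b l := by positivity
  nlinarith

end GenSwitch

theorem corollary1 {n L : ℕ} {M : Type*} [Fintype M] (G : GenSwitch n L M) (l : Fin L)
    (hl : G.IsFacet l) (ν : Fin n → ℝ) (hν : ν ∈ intrinsicInterior ℝ (G.face l))
    (Amax : ℕ) (θ : ℝ) (hθ : 0 < θ) :
    (∀ ε : ℝ, 0 < ε → ε < 1 → ∀ α : PMF (Fin n → ℕ),
      GenSwitch.IsArrivalLaw ((1 - ε) • ν) Amax α →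
      ∀ (σ : (Fin n → ℕ) → M → PMF (Fin n → ℕ)) (π : PMF (Fin n → ℕ)),
        G.IsPolicy σ → G.IsSteadyState α σ π → G.FiniteMean l π →
          G.ULB l α ε - ε * (G.bMax - G.b l) / 2 ≤ G.meanQueue l π) ∧
    ∃ ε₀ β : ℝ, 0 < ε₀ ∧ ε₀ < 1 ∧
      ∀ ε : ℝ, 0 < ε → ε < ε₀ → ∀ α : PMF (Fin n → ℕ),
        GenSwitch.IsArrivalLaw ((1 - ε) • ν) Amax α →
        ∀ (σ : (Fin n → ℕ) → M → PMF (Fin n → ℕ)) (π : PMF (Fin n → ℕ)),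
          G.IsMaxWeight θ σ → G.IsSteadyState α σ π →
            G.FiniteMean l π ∧
            G.ULB l α ε ≤ G.meanQueue l π ∧
            G.meanQueue l π ≤ G.ULB l α ε + β * Real.log (1 / ε) ∧
            ∀ (σ' : (Fin n → ℕ) → M → PMF (Fin n → ℕ)) (π' : PMF (Fin n → ℕ)),
              G.IsPolicy σ' → G.IsSteadyState α σ' π' → G.FiniteMean l π' →
                G.meanQueue l π ≤ G.meanQueue l π' + β * Real.log (1 / ε) := by
  have hνf := intrinsicInterior_subset hν
  refine ⟨fun ε hε _ α hα σ π hσ hπ hfin => hπ.universal_lower_bound hνf hε hσ hα hfin, ?_⟩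
  obtain ⟨κ₀, hκ₀, hslack⟩ := GenSwitch.exists_lossSlack_ge hνf Amax hθ
  obtain ⟨ε₁, hε₁, κ, hκ, C, hC, hcollapse⟩ := hl.exists_stateSpaceCollapse hν Amax θ
  obtain ⟨C₁, C₂, hC₁, hC₂, hU⟩ := G.exists_next_mul_lostService_le l Amax θ
  obtain ⟨m, -, hBm⟩ := GenSwitch.exists_maxService_pos hνf
  have hbM : 0 < G.bMax := hBm.trans_le (G.maxService_le_bMax l m)
  have hb := G.b_pos l
  refine ⟨min (1 / 2) (min ε₁ (κ₀ / G.bMax)),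
    2 * (G.b l + G.bMax + C₁ + C₂ / κ * G.bMax * C / G.b l) + C₂ / κ, by positivity,
    (min_le_left _ _).trans_lt (by norm_num), fun ε hε hε₀ α hα σ π hσ hπ => ?_⟩
  obtain ⟨h1, h2⟩ := lt_min_iff.1 hε₀
  obtain ⟨h3, h4⟩ := lt_min_iff.1 h2
  rw [lt_div_iff₀ hbM] at h4
  have hfin := hπ.finiteMean_of_isMaxWeight hνf.1 l hε (by linarith) hσ hα
  obtain ⟨hexp, hexpC⟩ := hcollapse ε hε h3 α hα σ π hσ hπ
  have hup := hπ.maxWeight_upper_bound hνf hε h1.le hκ hC hC₁ hC₂ hσ.isPolicy hα (hU σ hσ)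
    hexp hexpC hfin
  refine ⟨hfin, hπ.maxWeight_lower_bound hνf hε h4.le hσ.isPolicy hα
    (hslack ε h1.le α hα σ hσ) hfin, by linarith, fun σ' π' hσ' hπ' hfin' => ?_⟩
  have hlow := hπ'.universal_lower_bound hνf hε hσ' hα hfin'
  -- The slack `bMax / 2` in the upper bound covers the correction term of the lower bound.
  have h5 : ε * (G.bMax - G.b l) / 2 ≤ G.bMax / 2 := by nlinarith
  linarith
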